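/- **Theorem 3.5 (beneficial and malignant multiplicative shifts on variance).** *Setting.* Let $1\le k\le n$ and let $\mathcal D_s$ be the law of a pair $(\mathbf x,y)\in\mathbb R^p\times\mathbb R$ with $y=\mathbf x^\top\theta+\varepsilon$, where $\mathbf x$ is centered, $\Sigma_s=\mathbb E[\mathbf x\mathbf x^\top]=\mathrm{diag}(\lambda_1,\dots,\lambda_p)$ with $\lambda_1\ge\dots\ge\lambda_p>0$; the whitened vector $\mathbf z=\Sigma_s^{-1/2}\mathbf x$ has independent coordinates and satisfies $\mathbb E\,e^{\gamma^\top\mathbf z}\le e^{\sigma^2\|\gamma\|^2/2}$ for all $\gamma\in\mathbb R^p$; and $\varepsilon$ is independent of $\mathbf x$, centered, with variance $v^2\in(0,\infty)$. Let $X\in\mathbb R^{n\times p}$ be the data matrix of $n$ i.i.d. observations. For a positive semidefinite $\Sigma$ put $$V(\Sigma)=\frac1{v^2}\,\mathbb E_{\boldsymbol\varepsilon}\big[\hat\theta(\boldsymbol\varepsilon)^\top\Sigma\,\hat\theta(\boldsymbol\varepsilon)\big],\qquad \hat\theta(\xi)=X^\top(XX^\top)^{-1}\xi ,$$ where $\boldsymbol\varepsilon\in\mathbb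 R^n$ has i.i.d. entries distributed as $\varepsilon$ and $X$ is held fixed (so $V$ is a function of the random matrix $X$). Put $$\rho_k=\frac{\sum_{i>k}\lambda_i}{n\lambda_{k+1}},\qquad R_k=\frac{(\sum_{i>k}\lambda_i)^2}{\sum_{i>k}\lambda_i^2}.$$ For $\alpha,\beta\ge0$ let $\Sigma_t=\mathrm{diag}(\tilde\lambda_i)$ with $\tilde\lambda_i=\alpha\lambda_i$ for $i\le k$ and $\tilde\lambda_i=\beta\lambda_i$ for $i>k$, and let $C_{\alpha\beta}=\left|\frac{\alpha-1}{1-\beta}\right|$ ($=\infty$ if $\beta=1$). The shift is *beneficial* in variance at $X$ if $V(\Sigma_t)<V(\Sigma_s)$ and *malignant* if $V(\Sigma_t)>V(\Sigma_s)$. *Claim.* For every $\sigma>0$ there are constants $b,c>1$ depending only on $\sigma$ such that the following holds. If $\rho_k\ge b$, then: 1. if $\alpha<1,\beta\le1$ or $\alpha\le1,\beta<1$, the shift is beneficial with probability at least $1-ce^{-n/c}$; 2. if $\alpha>1,\beta\ge1$ or $\alpha\ge1,\beta>1$, the shift is malignant with probability at least $1-ce^{-n/c}$. Now take a sequence of such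 problems, one for each sufficiently large sample size $n$, with $\sigma$ fixed, where $p,k,\lambda_i,\theta,\mathcal D_s$ and also $\alpha,\beta\ge 0$ may depend on $n$, with $\rho_k\ge b$ for all large $n$. Then, for all sufficiently large $n$, the shift has the stated type with probability at least $1-ce^{-n/c}$ in each of the following cases. 3. *Mildly overparameterized regime*, $n/R_k=\omega(C_{\alpha\beta}\,k/n)$ as $n\to\infty$: the shift is beneficial if $\alpha>1$ and $\beta<1$ (for all large $n$), and malignant if $\alpha<1$ and $\beta>1$ (for all large $n$). If $\alpha,\beta$ vary with $n$, it is assumed here that for some $a>0$ and all large $n$, $C_{\alpha\beta}\ge a$ or $k\le n/c$; for fixed $\alpha,\beta$ there is no such assumption. 4. *Severely overparameterized regime*, $n/R_k=o(C_{\alpha\beta}\,k/n)$ as $n\to\infty$, with $k=\min\{j:\rho_j\ge b\}$: the shift is malignant if $\alpha>1$ and $\beta<1$ (for all large $n$), and beneficial if $\alpha<1$ and $\beta>1$ (for all large $n$). -/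

import Mathlib

open MeasureTheory ProbabilityTheory Filter Asymptotics Topology
open scoped Matrix

noncomputable section

namespace MNI

/-- The uncentered second moment matrix `E[x xᵀ]` of a distribution `D` of pairs `(x, y)`. -/
def covMatrix {p : ℕ} (D : Measure ((Fin p → ℝ) × ℝ)) : Matrix (Fin p) (Fin p) ℝ :=
  Matrix.of fun i j => ∫ q, q.1 i * q.1 j ∂D

/-- The whitened observation `z = Σ^{-1/2} x` for the diagonal covariance `Σ = diag l`. -/
def whiten {p : ℕ} (l x : Fin p → ℝ) : Fin p → ℝ := fun i => x i / √(l i)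

/-- The response noise `ε = y - xᵀ θ` of an observation `(x, y)`. -/
def noise {p : ℕ} (θ : Fin p → ℝ) (q : (Fin p → ℝ) × ℝ) : ℝ := q.2 - q.1 ⬝ᵥ θ

/-- `D` is the distribution of a well-specified linear regression problem `y = xᵀ θ + ε`, written in
an eigenbasis of the covariance matrix. The eigenvalues `l` are positive (so that `x` can be
whitened) and non-increasing, the whitened vector has independent coordinates and is subgaussian
with parameter `σ`, and `ε` is centered noise of finite positive variance independent of `x`. -/
structure IsLinearRegression {p : ℕ} (D : Measure ((Fin p → ℝ) × ℝ)) (l θ : Fin p → ℝ) (σ : ℝ) :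
    Prop where
  isProbabilityMeasure : IsProbabilityMeasure D
  eigenvalue_pos : ∀ i, 0 < l i
  eigenvalue_antitone : Antitone l
  centered : ∀ i, ∫ q, q.1 i ∂D = 0
  covariance : covMatrix D = Matrix.diagonal l
  indep_coordinates : iIndepFun (fun (i : Fin p) (q : (Fin p → ℝ) × ℝ) => whiten l q.1 i) D
  subgaussian : ∀ γ : Fin p → ℝ, Integrable (fun q => Real.exp (γ ⬝ᵥ whiten l q.1)) D ∧
    ∫ q, Real.exp (γ ⬝ᵥ whiten l q.1) ∂D ≤ Real.exp (σ ^ 2 * (γ ⬝ᵥ γ) / 2)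
  noise_indep : IndepFun (fun q : (Fin p → ℝ) × ℝ => q.1) (noise θ) D
  noise_memLp : MemLp (noise θ) 2 D
  noise_centered : ∫ q, noise θ q ∂D = 0
  noise_variance_pos : 0 < Var[noise θ; D]

/-- The `n × p` data matrix whose rows are the inputs of the sample `S`. -/
def dataMatrix {n p : ℕ} (S : Fin n → (Fin p → ℝ) × ℝ) : Matrix (Fin n) (Fin p) ℝ :=
  Matrix.of fun i j => (S i).1 j

/-- The minimum-norm interpolator `Xᵀ (X Xᵀ)⁻¹ ξ` of the labels `ξ`. -/
def mni {n p : ℕ} (X : Matrix (Fin n) (Fin p) ℝ) (ξ : Fin n → ℝ) : Fin p → ℝ :=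
  Xᵀ *ᵥ ((X * Xᵀ)⁻¹ *ᵥ ξ)

/-- `V_ε = ‖mni(ε)‖²` in the quadratic form `‖u‖² = uᵀ T u` of the test covariance `T`. -/
def noiseRisk {n p : ℕ} (T : Matrix (Fin p) (Fin p) ℝ) (X : Matrix (Fin n) (Fin p) ℝ)
    (ε : Fin n → ℝ) : ℝ :=
  mni X ε ⬝ᵥ (T *ᵥ mni X ε)

/-- The normalized variance `V = E_ε[V_ε / v²]` at the data matrix `X` for test covariance `T`: the
expectation is over a noise vector with i.i.d. entries, distributed as the response noise
of `D`, and `v²` is the variance of that noise. -/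
def variance {n p : ℕ} (D : Measure ((Fin p → ℝ) × ℝ)) (θ : Fin p → ℝ)
    (T : Matrix (Fin p) (Fin p) ℝ) (X : Matrix (Fin n) (Fin p) ℝ) : ℝ :=
  ∫ ε, noiseRisk T X ε / Var[noise θ; D] ∂(Measure.pi fun _ : Fin n => D.map (noise θ))

/-- The shift from `D` to a target with covariance `T` is beneficial in variance at `X`. -/
def BeneficialShift {n p : ℕ} (D : Measure ((Fin p → ℝ) × ℝ)) (θ : Fin p → ℝ)
    (T : Matrix (Fin p) (Fin p) ℝ) (X : Matrix (Fin n) (Fin p) ℝ) : Prop :=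
  variance D θ T X < variance D θ (covMatrix D) X

/-- The shift from `D` to a target with covariance `T` is malignant in variance at `X`. -/
def MalignantShift {n p : ℕ} (D : Measure ((Fin p → ℝ) × ℝ)) (θ : Fin p → ℝ)
    (T : Matrix (Fin p) (Fin p) ℝ) (X : Matrix (Fin n) (Fin p) ℝ) : Prop :=
  variance D θ (covMatrix D) X < variance D θ T X

/-- The probability that the data matrix of `n` i.i.d. observations from `D` satisfies `E`. -/
def sampleProb {p : ℕ} (n : ℕ) (D : Measure ((Fin p → ℝ) × ℝ))
    (E : Matrix (Fin n) (Fin p) ℝ → Prop) : ℝ :=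
  (Measure.pi fun _ : Fin n => D).real {S | E (dataMatrix S)}

/-- `∑_{i > k} λ_i` for 1-based indices; `l i` is the 1-based `λ_{i+1}`. -/
def tailSum {p : ℕ} (l : Fin p → ℝ) (k : ℕ) : ℝ :=
  ∑ i, if k ≤ i.val then l i else 0

/-- `ρ_k = (∑_{i > k} λ_i) / (n λ_{k+1})`, and `0` for `k ≥ p`, where the tail is empty. -/
def rho {p : ℕ} (n : ℕ) (l : Fin p → ℝ) (k : ℕ) : ℝ :=
  if h : k < p then tailSum l k / (n * l ⟨k, h⟩) else 0

/-- `R_k = (∑_{i > k} λ_i)² / ∑_{i > k} λ_i²`. -/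
def effRank {p : ℕ} (l : Fin p → ℝ) (k : ℕ) : ℝ :=
  tailSum l k ^ 2 / tailSum (fun i => l i ^ 2) k

/-- The target covariance: the top `k` eigenvalues are scaled by `α` and the others by `β`. -/
def shiftedCov {p : ℕ} (l : Fin p → ℝ) (k : ℕ) (α β : ℝ) : Matrix (Fin p) (Fin p) ℝ :=
  Matrix.diagonal fun i => if i.val < k then α * l i else β * l i

/-- `C_{αβ} = |(α - 1) / (1 - β)|`, used only for `β ≠ 1`. -/
def shiftRatio (α β : ℝ) : ℝ := |(α - 1) / (1 - β)|

/-- Mild overparameterization, `n / R_k = ω(C_{αβ} k / n)` as `n → ∞`. Since `C_{αβ} = ∞` for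
`β = 1`, that value is excluded. -/
def MildlyOverparameterized (p k : ℕ → ℕ) (l : ∀ n, Fin (p n) → ℝ) (α β : ℕ → ℝ) : Prop :=
  (∀ᶠ n in atTop, β n ≠ 1) ∧
  (fun n : ℕ => shiftRatio (α n) (β n) * ((k n : ℝ) / n)) =o[atTop]
    (fun n : ℕ => (n : ℝ) / effRank (l n) (k n))

/-- Severe overparameterization, `n / R_k = o(C_{αβ} k / n)` as `n → ∞`. Since `C_{αβ} = ∞` for
`β = 1`, there is no condition at those `n`. -/
def SeverelyOverparameterized (p k : ℕ → ℕ) (l : ∀ n, Fin (p n) → ℝ) (α β : ℕ → ℝ) : Prop :=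
  (fun n : ℕ => (n : ℝ) / effRank (l n) (k n)) =o[atTop ⊓ 𝓟 {n | β n ≠ 1}]
    (fun n : ℕ => shiftRatio (α n) (β n) * ((k n : ℝ) / n))

end MNI

end

open MNI

/-! ### Exponential moments of squares and tails of weighted sums of squares -/

open scoped NNReal ENNReal

/-! Let z_i in R^n be the vector of the i-th whitened feature over the sample, A = X Xᵀ = ∑ λ_i z_i
z_iᵀ and y_i = A⁻¹ z_i. Averaging over the noise gives V(diag t) = ∑ t_i λ_i ‖y_i‖²
(`exists_variance_eq`), so the shift changes the variance by (α - 1) H + (β - 1) T, where H and T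
are the sums of λ_i² ‖y_i‖² over i ≤ k and i > k (`ShiftGap`). Claims 1 and 2 only need H > 0 and T
> 0, that is, A invertible and one nonzero z_i in each block. Claims 3 and 4 compare C_{αβ} H with
T: in the mild regime H ≲ k/n and T ≳ n/R_k, in the severe regime H ≳ k/n and T ≲ n/R_k.

The probabilistic input is that, when ρ_k is large, the tail operator A_k = ∑_{i>k} λ_i z_i z_iᵀ
lies between constant multiples of s = ∑_{i>k} λ_i, and that at most n/C fixed features satisfy ‖∑
g_j z_j‖² ≥ (n/8) ∑ g_j². Both follow from tails of weighted sums of squares and a net on the sphere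
of the column space (`IsSubgaussianFamily.norm_sq_le`, `exists_const_le_norm_sq`). For A_k this
sphere lies in R^n, so p enters only through the total weight.

The rest is deterministic. H is bounded above by `norm_head_solution_sq_le`, whose bound does not
involve the head eigenvalues. Lower bounds come from `le_norm_solution`: ‖y_i‖ is at least the
distance of z_i from the span of chosen features divided by the norm of the remaining operator. For
T the head features are projected out; a union bound over the tail indices would cost a factor p, so
only most of the weight λ_i² is controlled, by Markov's inequality
(`measureReal_good_weight_lt_le`). For H the other leading features are projected out, and
minimality of k makes what remains at most of order n λ_i. Finally T ≲ n/R_k follows from ‖y_i‖ ≤ 8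
‖z_i‖ / s and concentration of ∑_{i>k} λ_i² ‖z_i‖². -/

/-- A subgaussian variable with variance proxy `c` satisfies `E exp (3 X² / (8 c)) ≤ 2`. -/
lemma integral_exp_sq_le_two_of_subgaussian {Ω : Type*} {mΩ : MeasurableSpace Ω} {μ : Measure Ω}
    [IsProbabilityMeasure μ] {X : Ω → ℝ} (hXm : Measurable X) {c : ℝ≥0} (hc : 0 < c)
    (hX : HasSubgaussianMGF X c μ) :
    Integrable (fun ω => Real.exp (3 / (8 * c) * X ω ^ 2)) μ ∧
      ∫ ω, Real.exp (3 / (8 * c) * X ω ^ 2) ∂μ ≤ 2 := by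
  have hc' : (0 : ℝ) < c := hc
  -- Gaussian linearization: for t ~ N(0, v), E exp(t x) = exp(v x² / 2), so exchanging the
  -- integrals leaves E exp(c t² / 2) = (1 - c v)^(-1/2). The choice c v = 3/4 makes this 2.
  set v : ℝ≥0 := 3 / (4 * c) with hv
  have hvr : (v : ℝ) = 3 / (4 * c) := by simp [hv]
  have hv0 : v ≠ 0 := by
    intro h
    have : (v : ℝ) = 0 := by simp [h]
    rw [hvr] at this
    have : (0 : ℝ) < 3 / (4 * c) := by positivity
    linarith
  have gauss : ∀ x : ℝ, ∫⁻ t, ENNReal.ofReal (Real.exp (t * x)) ∂(gaussianReal 0 v)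
      = ENNReal.ofReal (Real.exp (3 / (8 * c) * x ^ 2)) := by
    intro x
    have h1 : ∫ t, Real.exp (x * t) ∂(gaussianReal 0 v) = Real.exp (3 / (8 * c) * x ^ 2) := by
      have := congrFun (mgf_fun_id_gaussianReal (μ := 0) (v := v)) x
      simp only [mgf] at this
      rw [this, hvr]
      congr 1
      field_simp
      ring
    have h2 : Integrable (fun t => Real.exp (x * t)) (gaussianReal 0 v) := by
      -- A non-integrable function has integral 0 by convention, which the positive value in `h1`
      -- excludes.
      by_contra h
      rw [integral_undef h] at h1
      exact (Real.exp_pos _).ne h1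
    rw [← h1, ofReal_integral_eq_lintegral_ofReal h2 (ae_of_all _ fun _ => (Real.exp_pos _).le)]
    simp_rw [mul_comm]
  have key : ∫⁻ ω, ENNReal.ofReal (Real.exp (3 / (8 * c) * X ω ^ 2)) ∂μ ≤ ENNReal.ofReal 2 := by
    simp_rw [← gauss]
    rw [lintegral_lintegral_swap (by
      refine Measurable.aemeasurable ?_
      simp only [Function.uncurry_def]
      fun_prop)]
    have h1 : ∀ t : ℝ, ∫⁻ ω, ENNReal.ofReal (Real.exp (t * X ω)) ∂μ
        ≤ ENNReal.ofReal (Real.exp (c * t ^ 2 / 2)) := by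
      intro t
      rw [← ofReal_integral_eq_lintegral_ofReal (hX.integrable_exp_mul t)
        (ae_of_all _ fun _ => (Real.exp_pos _).le)]
      exact ENNReal.ofReal_le_ofReal (hX.mgf_le t)
    refine (lintegral_mono h1).trans ?_
    have hprod : ∀ t : ℝ, gaussianPDFReal 0 v t * Real.exp (c * t ^ 2 / 2)
        = (√(2 * Real.pi * v))⁻¹ * Real.exp (-(c / 6) * t ^ 2) := by
      intro t
      rw [gaussianPDFReal, mul_assoc, ← Real.exp_add, hvr]
      congr 2
      field_simp
      ring
    have hint : ∫ t, Real.exp (c * t ^ 2 / 2) ∂(gaussianReal 0 v) = 2 := by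
      rw [integral_gaussianReal_eq_integral_smul hv0]
      simp only [smul_eq_mul, hprod]
      rw [integral_const_mul, integral_gaussian, ← Real.sqrt_inv, ← Real.sqrt_mul (by positivity),
        hvr]
      have : (2 * Real.pi * (3 / (4 * (c : ℝ))))⁻¹ * (Real.pi / (c / 6)) = 2 ^ 2 := by
        field_simp
        ring
      rw [this, Real.sqrt_sq (by norm_num)]
    have hint' : Integrable (fun t => Real.exp (c * t ^ 2 / 2)) (gaussianReal 0 v) := by
      by_contra h
      rw [integral_undef h] at hint
      norm_num at hint
    rw [← ofReal_integral_eq_lintegral_ofReal hint' (ae_of_all _ fun _ => (Real.exp_pos _).le),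
      hint]
  have hm : Measurable fun ω => Real.exp (3 / (8 * c) * X ω ^ 2) := by fun_prop
  refine ⟨⟨hm.aestronglyMeasurable, ?_⟩, ?_⟩
  · rw [hasFiniteIntegral_iff_ofReal (ae_of_all _ fun _ => (Real.exp_pos _).le)]
    exact key.trans_lt ENNReal.ofReal_lt_top
  · rw [integral_eq_lintegral_of_nonneg_ae (ae_of_all _ fun _ => (Real.exp_pos _).le)
      hm.aestronglyMeasurable]
    calc _ ≤ (ENNReal.ofReal 2).toReal := ENNReal.toReal_mono ENNReal.ofReal_ne_top key
      _ = 2 := by simp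

/-- Bernoulli's inequality for `exp`: `exp (r x) ≤ 1 + r (exp x - 1)` for `0 ≤ r ≤ 1`. -/
lemma Real.exp_mul_le_one_add {r x : ℝ} (hr0 : 0 ≤ r) (hr1 : r ≤ 1) :
    Real.exp (r * x) ≤ 1 + r * (Real.exp x - 1) := by
  have := convexOn_exp.2 (Set.mem_univ x) (Set.mem_univ 0) hr0 (sub_nonneg.2 hr1) (by ring)
  simp only [smul_eq_mul, mul_zero, add_zero, Real.exp_zero, mul_one] at this
  linarith

section SquareExponential

variable {Ω : Type*} {mΩ : MeasurableSpace Ω} {μ : Measure Ω} [IsProbabilityMeasure μ]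

/-- The chord bound for `exp` turns the moment bound 2 into 1 + r ≤ exp r. In this form the bounds
of independent summands multiply and their exponents add up to the total weight. -/
lemma mgf_sq_le {X : Ω → ℝ} (hXm : Measurable X) {h r : ℝ}
    (hi : Integrable (fun ω => Real.exp (h * X ω ^ 2)) μ)
    (h2 : ∫ ω, Real.exp (h * X ω ^ 2) ∂μ ≤ 2) (hr0 : 0 ≤ r) (hr1 : r ≤ 1) :
    Integrable (fun ω => Real.exp (r * (h * X ω ^ 2))) μ ∧
      ∫ ω, Real.exp (r * (h * X ω ^ 2)) ∂μ ≤ Real.exp r := by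
  have hi' : Integrable (fun ω => r * (Real.exp (h * X ω ^ 2) - 1)) μ :=
    (hi.sub (integrable_const 1)).const_mul r
  have hdom : Integrable (fun ω => 1 + r * (Real.exp (h * X ω ^ 2) - 1)) μ :=
    (integrable_const 1).add hi'
  have hint : Integrable (fun ω => Real.exp (r * (h * X ω ^ 2))) μ := by
    refine hdom.mono' (by fun_prop) (ae_of_all _ fun ω => ?_)
    rw [Real.norm_eq_abs, abs_of_pos (Real.exp_pos _)]
    exact Real.exp_mul_le_one_add hr0 hr1
  refine ⟨hint, (integral_mono hint hdom fun ω => Real.exp_mul_le_one_add hr0 hr1).trans ?_⟩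
  rw [integral_add (integrable_const 1) hi',
    integral_const_mul, integral_sub hi (integrable_const 1)]
  simp only [integral_const, probReal_univ, smul_eq_mul, mul_one]
  have := Real.add_one_le_exp r
  nlinarith

lemma Real.exp_neg_le_quadratic {x : ℝ} (hx : 0 ≤ x) : Real.exp (-x) ≤ 1 - x + x ^ 2 / 2 := by
  have h1 := Real.quadratic_le_exp_of_nonneg hx
  rw [Real.exp_neg, inv_le_comm₀ (Real.exp_pos _) (by nlinarith [sq_nonneg (x - 1)])]
  refine le_trans ?_ h1
  rw [inv_le_iff_one_le_mul₀ (by nlinarith [sq_nonneg (x - 1)])]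
  -- (1 + x + x²/2)(1 - x + x²/2) = 1 + x⁴/4.
  nlinarith [sq_nonneg (x ^ 2)]

/-- Second-order expansion of the exponential: the unit second moment gives the exact linear term
-s, and u²/2 ≤ exp u at u = h X² bounds the fourth moment by 4 / h². -/
lemma mgf_neg_sq_le {X : Ω → ℝ} (hXm : Measurable X) {h s : ℝ} (hh : 0 < h)
    (hi : Integrable (fun ω => Real.exp (h * X ω ^ 2)) μ)
    (h2 : ∫ ω, Real.exp (h * X ω ^ 2) ∂μ ≤ 2) (h1 : ∫ ω, X ω ^ 2 ∂μ = 1) (hs : 0 ≤ s) :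
    Integrable (fun ω => Real.exp (-s * X ω ^ 2)) μ ∧
      ∫ ω, Real.exp (-s * X ω ^ 2) ∂μ ≤ Real.exp (-s + 2 / h ^ 2 * s ^ 2) := by
  have hX2 : Integrable (fun ω => X ω ^ 2) μ := by
    by_contra hn
    rw [integral_undef hn] at h1
    norm_num at h1
  have h4 : ∀ ω, X ω ^ 4 ≤ 2 / h ^ 2 * Real.exp (h * X ω ^ 2) := by
    intro ω
    have := Real.quadratic_le_exp_of_nonneg (x := h * X ω ^ 2) (by positivity)
    rw [div_mul_eq_mul_div, le_div_iff₀ (by positivity)]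
    have h0 : 0 ≤ h * X ω ^ 2 := by positivity
    nlinarith
  have hX4 : Integrable (fun ω => X ω ^ 4) μ := by
    refine (hi.const_mul (2 / h ^ 2)).mono' (by fun_prop) (ae_of_all _ fun ω => ?_)
    rw [Real.norm_eq_abs, abs_of_nonneg (by positivity)]
    exact h4 ω
  have hI4 : ∫ ω, X ω ^ 4 ∂μ ≤ 4 / h ^ 2 := by
    refine (integral_mono hX4 (hi.const_mul (2 / h ^ 2)) h4).trans ?_
    rw [integral_const_mul]
    calc _ ≤ 2 / h ^ 2 * 2 := by gcongr
      _ = _ := by ring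
  have hint : Integrable (fun ω => Real.exp (-s * X ω ^ 2)) μ := by
    refine (integrable_const (1 : ℝ)).mono' (by fun_prop) (ae_of_all _ fun ω => ?_)
    rw [Real.norm_eq_abs, abs_of_pos (Real.exp_pos _), Real.exp_le_one_iff]
    nlinarith [mul_nonneg hs (sq_nonneg (X ω))]
  have hdiff : Integrable (fun ω => 1 - s * X ω ^ 2) μ :=
    (integrable_const 1).sub (hX2.const_mul s)
  have hdom : Integrable (fun ω => (1 - s * X ω ^ 2) + s ^ 2 / 2 * X ω ^ 4) μ :=
    hdiff.add (hX4.const_mul _)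
  refine ⟨hint, (integral_mono hint hdom fun ω => ?_).trans ?_⟩
  · have := Real.exp_neg_le_quadratic (x := s * X ω ^ 2) (by positivity)
    simp only [neg_mul]
    refine this.trans (le_of_eq ?_)
    ring
  · rw [integral_add hdiff (hX4.const_mul _),
      integral_sub (integrable_const 1) (hX2.const_mul s), integral_const_mul, integral_const_mul,
      h1]
    simp only [integral_const, probReal_univ, smul_eq_mul, mul_one]
    refine le_trans ?_ (Real.add_one_le_exp _)
    have : s ^ 2 / 2 * ∫ ω, X ω ^ 4 ∂μ ≤ s ^ 2 / 2 * (4 / h ^ 2) := by gcongr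
    have e : s ^ 2 / 2 * (4 / h ^ 2) = 2 / h ^ 2 * s ^ 2 := by ring
    linarith

variable {ι : Type*} [Fintype ι] {X : ι → Ω → ℝ} {w : ι → ℝ} {W h : ℝ}

/-- Upper tail of a weighted sum of squares of independent subgaussian variables. -/
lemma measureReal_weighted_sq_ge_le (hind : iIndepFun X μ) (hXm : ∀ a, Measurable (X a))
    (hh : 0 < h) (hi : ∀ a, Integrable (fun ω => Real.exp (h * X a ω ^ 2)) μ)
    (h2 : ∀ a, ∫ ω, Real.exp (h * X a ω ^ 2) ∂μ ≤ 2) (hw0 : ∀ a, 0 ≤ w a) (hwW : ∀ a, w a ≤ W)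
    (hW : 0 < W) (t : ℝ) :
    μ.real {ω | (∑ a, w a + W * t) / h ≤ ∑ a, w a * X a ω ^ 2} ≤ Real.exp (-t) := by
  have hY : iIndepFun (fun a ω => w a * X a ω ^ 2) μ :=
    hind.comp (fun a x => w a * x ^ 2) fun a => by fun_prop
  have hYm : ∀ a, Measurable fun ω => w a * X a ω ^ 2 := fun a => by
    have := hXm a
    fun_prop
  -- Chernoff's bound with parameter h / W, the largest for which all ratios w a / W stay in [0, 1].
  have hb := fun a => mgf_sq_le (hXm a) (hi a) (h2 a) (r := w a / W)
    (div_nonneg (hw0 a) hW.le) ((div_le_one hW).2 (hwW a))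
  have he : ∀ a ω, Real.exp (h / W * (w a * X a ω ^ 2))
      = Real.exp (w a / W * (h * X a ω ^ 2)) := fun a ω => by
    congr 1
    field_simp
  have hint : Integrable (fun ω => Real.exp (h / W * (∑ a, fun ω => w a * X a ω ^ 2) ω)) μ := by
    refine hY.integrable_exp_mul_sum hYm fun a _ => ?_
    simp only [he]
    exact (hb a).1
  have hm : mgf (∑ a, fun ω => w a * X a ω ^ 2) μ (h / W) ≤ Real.exp ((∑ a, w a) / W) := by
    rw [hY.mgf_sum hYm, Finset.sum_div, Real.exp_sum]
    refine Finset.prod_le_prod (fun a _ => mgf_nonneg) fun a _ => ?_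
    simp only [mgf, he]
    exact (hb a).2
  have := measure_ge_le_exp_mul_mgf ((∑ a, w a + W * t) / h) (by positivity) hint
  simp only [Finset.sum_apply] at this
  refine this.trans ((mul_le_mul_of_nonneg_left hm (Real.exp_pos _).le).trans (le_of_eq ?_))
  rw [← Real.exp_add]
  congr 1
  field_simp
  ring

/-- Lower tail of a weighted sum of squares of independent subgaussian variables. -/
lemma measureReal_weighted_sq_le_le (hind : iIndepFun X μ) (hXm : ∀ a, Measurable (X a))
    (hh : 0 < h) (hi : ∀ a, Integrable (fun ω => Real.exp (h * X a ω ^ 2)) μ)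
    (h2 : ∀ a, ∫ ω, Real.exp (h * X a ω ^ 2) ∂μ ≤ 2) (h1 : ∀ a, ∫ ω, X a ω ^ 2 ∂μ = 1)
    (hw0 : ∀ a, 0 ≤ w a) (hwW : ∀ a, w a ≤ W) (hW : 0 < W) :
    μ.real {ω | ∑ a, w a * X a ω ^ 2 ≤ (∑ a, w a) / 2} ≤
      Real.exp (-(h ^ 2 / 32 * ((∑ a, w a) / W))) := by
  have hY : iIndepFun (fun a ω => w a * X a ω ^ 2) μ :=
    hind.comp (fun a x => w a * x ^ 2) fun a => by fun_prop
  have hYm : ∀ a, Measurable fun ω => w a * X a ω ^ 2 := fun a => by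
    have := hXm a
    fun_prop
  -- With Chernoff parameter h² / (8 W) the quadratic term is at most a quarter of the linear one,
  -- leaving -3h²/32 per unit of ∑ w / W. The threshold at half the mean gives back 2h²/32.
  have hb := fun a => mgf_neg_sq_le (hXm a) hh (hi a) (h2 a) (h1 a) (s := h ^ 2 / 8 / W * w a)
    (mul_nonneg (by positivity) (hw0 a))
  have he : ∀ a ω, Real.exp (-(h ^ 2 / 8 / W) * (w a * X a ω ^ 2))
      = Real.exp (-(h ^ 2 / 8 / W * w a) * X a ω ^ 2) := fun a ω => by
    congr 1
    ring
  have hint : Integrable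
      (fun ω => Real.exp (-(h ^ 2 / 8 / W) * (∑ a, fun ω => w a * X a ω ^ 2) ω)) μ := by
    refine hY.integrable_exp_mul_sum hYm fun a _ => ?_
    simp only [he]
    exact (hb a).1
  have hm : mgf (∑ a, fun ω => w a * X a ω ^ 2) μ (-(h ^ 2 / 8 / W)) ≤
      Real.exp (-(3 * h ^ 2 / 32 * ((∑ a, w a) / W))) := by
    rw [hY.mgf_sum hYm, Finset.sum_div, Finset.mul_sum, ← Finset.sum_neg_distrib, Real.exp_sum]
    refine Finset.prod_le_prod (fun a _ => mgf_nonneg) fun a _ => ?_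
    simp only [mgf, he]
    refine (hb a).2.trans (Real.exp_le_exp.2 ?_)
    have hu0 : 0 ≤ w a / W := div_nonneg (hw0 a) hW.le
    have hu1 : w a / W ≤ 1 := (div_le_one hW).2 (hwW a)
    have e : -(h ^ 2 / 8 / W * w a) + 2 / h ^ 2 * (h ^ 2 / 8 / W * w a) ^ 2
        = h ^ 2 / 32 * (-4 * (w a / W) + (w a / W) ^ 2) := by
      field_simp
      ring
    rw [e]
    have : h ^ 2 / 32 * (-4 * (w a / W) + (w a / W) ^ 2) ≤ h ^ 2 / 32 * (-3 * (w a / W)) := by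
      gcongr
      nlinarith
    linarith
  have := measure_le_le_exp_mul_mgf ((∑ a, w a) / 2)
    (neg_nonpos.2 (by positivity : 0 ≤ h ^ 2 / 8 / W)) hint
  simp only [Finset.sum_apply] at this
  refine this.trans ((mul_le_mul_of_nonneg_left hm (Real.exp_pos _).le).trans (le_of_eq ?_))
  rw [← Real.exp_add]
  congr 1
  ring

end SquareExponential

/-! ### Nets on the unit sphere and operator bounds from a net -/

section Net

variable {E F : Type*} [NormedAddCommGroup E] [NormedSpace ℝ E] [FiniteDimensional ℝ E]
  [NormedAddCommGroup F] [NormedSpace ℝ F]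

open Metric Module in
/-- Volumetric bound on the size of an `ε`-separated subset of the unit ball. -/
lemma card_le_of_separated_unitBall {ε : ℝ} (hε : 0 < ε) (s : Finset E) (hs : ∀ c ∈ s, ‖c‖ ≤ 1)
    (h : ∀ c ∈ s, ∀ d ∈ s, c ≠ d → ε ≤ ‖c - d‖) : (s.card : ℝ) ≤ (1 + 2 / ε) ^ finrank ℝ E := by
  borelize E
  let μ : Measure E := Measure.addHaar
  have hδ : 0 < ε / 2 := by positivity
  have hρ : 0 < 1 + ε / 2 := by positivity
  set A := ⋃ c ∈ s, ball (c : E) (ε / 2) with hA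
  have D : Set.Pairwise (s : Set E) (Function.onFun Disjoint fun c => ball (c : E) (ε / 2)) := by
    rintro c hc d hd hcd
    apply ball_disjoint_ball
    rw [dist_eq_norm]
    have := h c hc d hd hcd
    linarith
  have A_subset : A ⊆ ball (0 : E) (1 + ε / 2) := by
    refine Set.iUnion₂_subset fun x hx => ?_
    apply ball_subset_ball'
    rw [dist_zero_right]
    linarith [hs x hx]
  have I : (s.card : ℝ≥0∞) * ENNReal.ofReal ((ε / 2) ^ finrank ℝ E) * μ (ball 0 1) ≤
      ENNReal.ofReal ((1 + ε / 2) ^ finrank ℝ E) * μ (ball 0 1) :=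
    calc
      _ = μ A := by
        rw [hA, measure_biUnion_finset D fun c _ => measurableSet_ball]
        simp only [μ.addHaar_ball_of_pos _ hδ]
        simp only [Finset.sum_const, nsmul_eq_mul, mul_assoc]
      _ ≤ μ (ball (0 : E) (1 + ε / 2)) := measure_mono A_subset
      _ = _ := by simp only [μ.addHaar_ball_of_pos _ hρ]
  have J := (ENNReal.mul_le_mul_iff_left (measure_ball_pos μ (0 : E) zero_lt_one).ne'
    measure_ball_lt_top.ne).1 I
  have K := ENNReal.toReal_le_of_le_ofReal (pow_nonneg hρ.le _) J
  rw [ENNReal.toReal_mul, ENNReal.toReal_natCast,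
    ENNReal.toReal_ofReal (pow_nonneg hδ.le _), ← le_div_iff₀ (by positivity), ← div_pow] at K
  refine K.trans (le_of_eq ?_)
  congr 1
  field_simp
  ring

-- The volumetric bound makes the cardinality of an ε-separated subset of the sphere bounded, so a
-- largest one exists. It is a net, since an uncovered point could be added to it.
variable (E) in
lemma exists_sphere_net {ε : ℝ} (hε : 0 < ε) :
    ∃ N : Finset E, (∀ y ∈ N, ‖y‖ = 1) ∧ (∀ x : E, ‖x‖ = 1 → ∃ y ∈ N, ‖x - y‖ ≤ ε) ∧
      (N.card : ℝ) ≤ (1 + 2 / ε) ^ Module.finrank ℝ E := by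
  classical
  let P : Finset E → Prop := fun s =>
    (∀ c ∈ s, ‖c‖ = 1) ∧ ∀ c ∈ s, ∀ d ∈ s, c ≠ d → ε ≤ ‖c - d‖
  have hcard : ∀ s, P s → (s.card : ℝ) ≤ (1 + 2 / ε) ^ Module.finrank ℝ E := fun s hs =>
    card_le_of_separated_unitBall hε s (fun c hc => (hs.1 c hc).le) hs.2
  have hmem : sSup {m | ∃ s, P s ∧ s.card = m} ∈ {m | ∃ s, P s ∧ s.card = m} := by
    refine Nat.sSup_mem ⟨0, ∅, ⟨by simp, by simp⟩, by simp⟩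
      ⟨⌈(1 + 2 / ε) ^ Module.finrank ℝ E⌉₊, ?_⟩
    rintro m ⟨s, hs, rfl⟩
    exact Nat.cast_le.1 ((hcard s hs).trans (Nat.le_ceil _))
  have hbdd : BddAbove {m | ∃ s, P s ∧ s.card = m} := by
    refine ⟨⌈(1 + 2 / ε) ^ Module.finrank ℝ E⌉₊, ?_⟩
    rintro m ⟨s, hs, rfl⟩
    exact Nat.cast_le.1 ((hcard s hs).trans (Nat.le_ceil _))
  obtain ⟨N, hN, hNc⟩ := hmem
  refine ⟨N, hN.1, fun x hx => ?_, hcard N hN⟩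
  by_contra! hcon
  have hxN : x ∉ N := fun hxN => by
    have := hcon x hxN
    simp only [sub_self, norm_zero] at this
    linarith
  have hP : P (insert x N) := by
    refine ⟨fun c hc => ?_, fun c hc d hd hcd => ?_⟩
    · rcases Finset.mem_insert.1 hc with rfl | hc
      exacts [hx, hN.1 c hc]
    · rcases Finset.mem_insert.1 hc with hc | hc <;> rcases Finset.mem_insert.1 hd with hd | hd
      · exact absurd (hc.trans hd.symm) hcd
      · exact hc ▸ (hcon d hd).le
      · rw [norm_sub_rev]
        exact hd ▸ (hcon c hc).le
      · exact hN.2 c hc d hd hcd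
  have := le_csSup hbdd ⟨insert x N, hP, rfl⟩
  rw [Finset.card_insert_of_notMem hxN, ← hNc] at this
  omega

omit [FiniteDimensional ℝ E] in
lemma norm_le_of_forall_unit {L : E →ₗ[ℝ] F} {M : ℝ} (h : ∀ x, ‖x‖ = 1 → ‖L x‖ ≤ M) (x : E) :
    ‖L x‖ ≤ M * ‖x‖ := by
  rcases eq_or_ne x 0 with rfl | hx
  · simp
  have hx' : 0 < ‖x‖ := norm_pos_iff.2 hx
  have := h (‖x‖⁻¹ • x) (by rw [norm_smul, norm_inv, norm_norm, inv_mul_cancel₀ hx'.ne'])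
  rw [map_smul, norm_smul, norm_inv, norm_norm, inv_mul_le_iff₀ hx'] at this
  linarith

/-- Moving a unit vector to the net costs at most ε times the operator norm, so ‖L‖ ≤ B + ‖L‖ / 2.
Finite dimension makes ‖L‖ finite, and it can be absorbed. -/
lemma norm_le_of_net {N : Finset E} {ε : ℝ} (hε : ε ≤ 1 / 2)
    (hN : ∀ x : E, ‖x‖ = 1 → ∃ y ∈ N, ‖x - y‖ ≤ ε) {L : E →ₗ[ℝ] F} {B : ℝ} (hB0 : 0 ≤ B)
    (hB : ∀ y ∈ N, ‖L y‖ ≤ B) (x : E) : ‖L x‖ ≤ 2 * B * ‖x‖ := by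
  set L' := LinearMap.toContinuousLinearMap L with hL'
  have hLL' : ∀ x, L' x = L x := fun x => rfl
  have h1 : ∀ x, ‖x‖ = 1 → ‖L x‖ ≤ B + ‖L'‖ / 2 := by
    intro x hx
    obtain ⟨y, hy, hxy⟩ := hN x hx
    have e : L x = L y + L' (x - y) := by rw [hLL', map_sub]; abel
    rw [e]
    refine (norm_add_le _ _).trans (add_le_add (hB y hy) ((L'.le_opNorm _).trans ?_))
    have := mul_le_mul_of_nonneg_left (hxy.trans hε) (norm_nonneg L')
    linarith
  have h2 : ‖L'‖ ≤ B + ‖L'‖ / 2 :=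
    L'.opNorm_le_bound (by positivity) (norm_le_of_forall_unit h1)
  exact (L'.le_opNorm x).trans (mul_le_mul_of_nonneg_right (by linarith) (norm_nonneg x))

lemma le_norm_of_net {N : Finset E} {ε : ℝ} (hε : ε ≤ 1 / 2)
    (hN : ∀ x : E, ‖x‖ = 1 → ∃ y ∈ N, ‖x - y‖ ≤ ε) {L : E →ₗ[ℝ] F} {A B : ℝ} (hB0 : 0 ≤ B)
    (hB : ∀ y ∈ N, ‖L y‖ ≤ B) (hA : ∀ y ∈ N, A ≤ ‖L y‖) (x : E) :
    (A - 2 * B * ε) * ‖x‖ ≤ ‖L x‖ := by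
  rcases eq_or_ne x 0 with rfl | hx
  · simp
  have hx' : 0 < ‖x‖ := norm_pos_iff.2 hx
  have hu : ‖‖x‖⁻¹ • x‖ = 1 := by rw [norm_smul, norm_inv, norm_norm, inv_mul_cancel₀ hx'.ne']
  obtain ⟨y, hy, hxy⟩ := hN _ hu
  have h1 := norm_le_of_net hε hN hB0 hB (‖x‖⁻¹ • x - y)
  have h2 : ‖L y‖ ≤ ‖L (‖x‖⁻¹ • x)‖ + ‖L (‖x‖⁻¹ • x - y)‖ := by
    rw [map_sub]
    have := norm_sub_norm_le (L y) (L (‖x‖⁻¹ • x))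
    rw [norm_sub_rev] at this
    linarith
  have h3 : 2 * B * ‖‖x‖⁻¹ • x - y‖ ≤ 2 * B * ε := by gcongr
  have h4 : ‖L (‖x‖⁻¹ • x)‖ = ‖x‖⁻¹ * ‖L x‖ := by
    rw [map_smul, norm_smul, norm_inv, norm_norm]
  have h5 := hA y hy
  have h6 : A - 2 * B * ε ≤ ‖x‖⁻¹ * ‖L x‖ := by linarith
  rw [inv_mul_eq_div, le_div_iff₀ hx'] at h6
  exact h6

end Net

/-! ### Independent subgaussian arrays and their linear combinations -/

/-- The curried form of a jointly independent array is independent. -/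
lemma iIndepFun_curry {Ω ι κ : Type*} {mΩ : MeasurableSpace Ω} {P : Measure Ω}
    {X : ι × κ → Ω → ℝ} (mX : ∀ p, Measurable (X p)) (h : iIndepFun X P) :
    iIndepFun (fun a ω b => X (a, b) ω) P := by
  have := h.isProbabilityMeasure
  have hp : ∀ p, IsProbabilityMeasure (P.map (X p)) :=
    fun p => Measure.isProbabilityMeasure_map (mX p).aemeasurable
  -- Independence is read as the joint law being a product measure. Currying then identifies the
  -- product over pairs, written as a sigma type, with an iterated product.
  have h1 : iIndepFun (fun (q : (_ : ι) × κ) ω => X (q.1, q.2) ω) P :=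
    h.precomp (g := fun q : (_ : ι) × κ => (q.1, q.2)) (by rintro ⟨a, b⟩ ⟨c, d⟩ h; simpa using h)
  have h2 : ∀ a, iIndepFun (fun b ω => X (a, b) ω) P := fun a =>
    h.precomp (g := fun b => (a, b)) (by intro b c h; simpa using h)
  rw [iIndepFun_iff_map_fun_eq_infinitePi_map (by fun_prop)] at h1
  have h3 := fun a => (iIndepFun_iff_map_fun_eq_infinitePi_map (by fun_prop)).1 (h2 a)
  rw [iIndepFun_iff_map_fun_eq_infinitePi_map (by fun_prop)]
  simp_rw [h3]
  have hc := Measure.infinitePi_map_piCurry (fun (a : ι) (b : κ) => P.map (X (a, b)))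
  rw [← hc, ← h1, Measure.map_map (by fun_prop) (by fun_prop)]
  rfl

/-- Independent centered subgaussian random variables of unit variance. -/
structure IsSubgaussianFamily {Ω ι : Type*} {mΩ : MeasurableSpace Ω} (X : ι → Ω → ℝ) (c : ℝ≥0)
    (μ : Measure Ω) : Prop where
  measurable : ∀ i, Measurable (X i)
  indep : iIndepFun X μ
  subgaussian : ∀ i, HasSubgaussianMGF (X i) c μ
  integral_eq_zero : ∀ i, ∫ ω, X i ω ∂μ = 0
  integral_sq : ∀ i, ∫ ω, X i ω ^ 2 ∂μ = 1

namespace IsSubgaussianFamily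

variable {Ω ι κ : Type*} {mΩ : MeasurableSpace Ω} {μ : Measure Ω} {c : ℝ≥0}

lemma precomp {X : ι → Ω → ℝ} (hX : IsSubgaussianFamily X c μ) {g : κ → ι}
    (hg : Function.Injective g) : IsSubgaussianFamily (fun b => X (g b)) c μ :=
  ⟨fun _ => hX.measurable _, hX.indep.precomp hg, fun _ => hX.subgaussian _,
    fun _ => hX.integral_eq_zero _, fun _ => hX.integral_sq _⟩

lemma integral_linearCombination_sq [Fintype ι] {X : ι → Ω → ℝ} (hX : IsSubgaussianFamily X c μ)
    (g : ι → ℝ) : ∫ ω, (∑ i, X i ω * g i) ^ 2 ∂μ = ∑ i, g i ^ 2 := by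
  have := hX.indep.isProbabilityMeasure
  have hL : ∀ i, MemLp (fun ω => X i ω * g i) 2 μ := fun i => by
    simpa [mul_comm] using ((hX.subgaussian i).memLp 2).const_mul (g i)
  have hind : iIndepFun (fun i ω => X i ω * g i) μ :=
    hX.indep.comp (fun i x => x * g i) fun i => by fun_prop
  have h0 : ∫ ω, (∑ i, fun ω => X i ω * g i) ω ∂μ = 0 := by
    simp only [Finset.sum_apply]
    rw [integral_finsetSum _ fun i _ => (hL i).integrable (by norm_num)]
    simp [integral_mul_const, hX.integral_eq_zero]
  have hv := IndepFun.variance_sum (s := Finset.univ) (fun i _ => hL i)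
    (fun i _ j _ hij => hind.indepFun hij)
  have hs : MemLp (∑ i, fun ω => X i ω * g i) 2 μ := memLp_finsetSum' _ fun i _ => hL i
  rw [variance_of_integral_eq_zero hs.aestronglyMeasurable.aemeasurable h0] at hv
  simp only [Finset.sum_apply] at hv
  rw [hv]
  refine Finset.sum_congr rfl fun i _ => ?_
  rw [variance_of_integral_eq_zero (hL i).aestronglyMeasurable.aemeasurable
    (by simp [integral_mul_const, hX.integral_eq_zero])]
  simp [mul_pow, integral_mul_const, hX.integral_sq]

/-- The proxies of independent summands add to ∑ g_b² c = c. Applying the random matrix to a fixed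
unit vector therefore yields a family of the same kind, and the scalar tail bounds apply at each
point of a net. -/
lemma linearCombination [Fintype κ] {X : ι × κ → Ω → ℝ} (hX : IsSubgaussianFamily X c μ)
    {g : κ → ℝ} (hg : ∑ b, g b ^ 2 = 1) :
    IsSubgaussianFamily (fun a ω => ∑ b, X (a, b) ω * g b) c μ where
  measurable a := by
    have := hX.measurable
    fun_prop
  indep := (iIndepFun_curry hX.measurable hX.indep).comp (fun _ x => ∑ b, x b * g b)
    fun _ => by fun_prop
  subgaussian a := by
    have h1 : iIndepFun (fun b ω => g b * X (a, b) ω) μ :=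
      (hX.indep.precomp (g := fun b => (a, b)) (by intro b c h; simpa using h)).comp
        (fun b x => g b * x) fun b => by fun_prop
    have h2 := HasSubgaussianMGF.sum_of_iIndepFun h1 (s := Finset.univ)
      fun b _ => (hX.subgaussian (a, b)).const_mul (g b)
    convert h2 using 1
    · funext ω
      simp [mul_comm]
    · apply NNReal.coe_injective
      rw [NNReal.coe_sum]
      change (c : ℝ) = ∑ b, g b ^ 2 * (c : ℝ)
      rw [← Finset.sum_mul, hg, one_mul]
  integral_eq_zero a := by
    have := hX.indep.isProbabilityMeasure
    rw [integral_finsetSum _ fun b _ => ((hX.subgaussian (a, b)).integrable).mul_const _]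
    simp [integral_mul_const, hX.integral_eq_zero]
  integral_sq a := by
    rw [(hX.precomp (g := fun b => (a, b)) (by intro b c h; simpa using h)
      ).integral_linearCombination_sq g, hg]

end IsSubgaussianFamily

/-! ### Extreme singular values of row-weighted subgaussian matrices -/

section RandomMatrix

/-- The linear map `g ↦ (√(w a) ∑ b, M (a, b) g b)_a` between Euclidean spaces. -/
noncomputable def weightedMap {ι κ : Type*} [Fintype ι] [Fintype κ] (w : ι → ℝ) (M : ι × κ → ℝ) :
    EuclideanSpace ℝ κ →ₗ[ℝ] EuclideanSpace ℝ ι where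
  toFun g := WithLp.toLp 2 fun a => √(w a) * ∑ b, M (a, b) * g b
  map_add' x y := by
    ext a
    simp [mul_add, Finset.sum_add_distrib]
  map_smul' r x := by
    ext a
    simp only [PiLp.smul_apply, smul_eq_mul, RingHom.id_apply, mul_left_comm _ r, ← Finset.mul_sum]

lemma norm_sq_weightedMap {ι κ : Type*} [Fintype ι] [Fintype κ] {w : ι → ℝ} (hw : ∀ a, 0 ≤ w a)
    (M : ι × κ → ℝ) (g : EuclideanSpace ℝ κ) :
    ‖weightedMap w M g‖ ^ 2 = ∑ a, w a * (∑ b, M (a, b) * g b) ^ 2 := by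
  rw [EuclideanSpace.norm_sq_eq]
  refine Finset.sum_congr rfl fun a _ => ?_
  simp [weightedMap, mul_pow, Real.sq_sqrt (hw a)]

variable {Ω ι κ : Type*} {mΩ : MeasurableSpace Ω} {μ : Measure Ω} [IsProbabilityMeasure μ]
  [Fintype ι] [Fintype κ] {c : ℝ≥0} {X : ι × κ → Ω → ℝ} {w : ι → ℝ} {W : ℝ}

lemma IsSubgaussianFamily.measureReal_upper_tail (hX : IsSubgaussianFamily X c μ) (hc : 0 < c)
    (hw0 : ∀ a, 0 ≤ w a) (hwW : ∀ a, w a ≤ W) (hW : 0 < W) {g : EuclideanSpace ℝ κ}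
    (hg : ‖g‖ = 1) (t : ℝ) :
    μ.real {ω | (∑ a, w a + W * t) / (3 / (8 * c)) ≤ ‖weightedMap w (X · ω) g‖ ^ 2} ≤
      Real.exp (-t) := by
  have hY := hX.linearCombination (g := g) (by rw [← EuclideanSpace.real_norm_sq_eq, hg, one_pow])
  have he := fun a => integral_exp_sq_le_two_of_subgaussian (hY.measurable a) hc (hY.subgaussian a)
  simp only [norm_sq_weightedMap hw0]
  exact measureReal_weighted_sq_ge_le hY.indep hY.measurable
    (div_pos three_pos (mul_pos (by norm_num) hc)) (fun a => (he a).1) (fun a => (he a).2)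
    hw0 hwW hW t

lemma IsSubgaussianFamily.measureReal_lower_tail (hX : IsSubgaussianFamily X c μ) (hc : 0 < c)
    (hw0 : ∀ a, 0 ≤ w a) (hwW : ∀ a, w a ≤ W) (hW : 0 < W) {g : EuclideanSpace ℝ κ}
    (hg : ‖g‖ = 1) :
    μ.real {ω | ‖weightedMap w (X · ω) g‖ ^ 2 ≤ (∑ a, w a) / 2} ≤
      Real.exp (-((3 / (8 * c)) ^ 2 / 32 * ((∑ a, w a) / W))) := by
  have hY := hX.linearCombination (g := g) (by rw [← EuclideanSpace.real_norm_sq_eq, hg, one_pow])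
  have he := fun a => integral_exp_sq_le_two_of_subgaussian (hY.measurable a) hc (hY.subgaussian a)
  simp only [norm_sq_weightedMap hw0]
  exact measureReal_weighted_sq_le_le hY.indep hY.measurable
    (div_pos three_pos (mul_pos (by norm_num) hc)) (fun a => (he a).1) (fun a => (he a).2)
    hY.integral_sq hw0 hwW hW

lemma measureReal_exists_mem_le {Ω E : Type*} {mΩ : MeasurableSpace Ω} (μ : Measure Ω)
    [IsProbabilityMeasure μ] (N : Finset E) {S : E → Set Ω} {δ : ℝ}
    (h : ∀ y ∈ N, μ.real (S y) ≤ δ) : μ.real {ω | ∃ y ∈ N, ω ∈ S y} ≤ N.card * δ := by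
  have : {ω | ∃ y ∈ N, ω ∈ S y} = ⋃ y ∈ N, S y := by ext; simp
  rw [this]
  refine (measureReal_biUnion_finset_le N S).trans ?_
  rw [← nsmul_eq_mul]
  exact Finset.sum_le_card_nsmul _ _ _ h

/-- Upper bound on the norm of a random matrix with subgaussian entries and weighted rows. -/
theorem IsSubgaussianFamily.norm_sq_le (hX : IsSubgaussianFamily X c μ) (hc : 0 < c)
    (hw0 : ∀ a, 0 ≤ w a) (hwW : ∀ a, w a ≤ W) (hW : 0 < W) {t : ℝ} (ht : 0 ≤ t) :
    μ.real {ω | ¬ ∀ g : EuclideanSpace ℝ κ, ‖weightedMap w (X · ω) g‖ ^ 2 ≤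
        32 * c / 3 * 4 * (∑ a, w a + W * t) * ‖g‖ ^ 2} ≤
      5 ^ Fintype.card κ * Real.exp (-t) := by
  -- A 1/2-net has at most 5 ^ dim points and costs a factor 4 in the squared norm; the further
  -- factor 4 in the stated constant is slack.
  obtain ⟨N, hN1, hN, hNc⟩ := exists_sphere_net (EuclideanSpace ℝ κ) (ε := 1 / 2) (by norm_num)
  have hc' : (0 : ℝ) < c := hc
  rw [finrank_euclideanSpace] at hNc
  set Q : ℝ := (∑ a, w a + W * t) / (3 / (8 * c)) with hQ
  have hQ0 : 0 ≤ Q := by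
    have : 0 ≤ ∑ a, w a := Finset.sum_nonneg fun a _ => hw0 a
    positivity
  have hsub : {ω | ¬ ∀ g : EuclideanSpace ℝ κ, ‖weightedMap w (X · ω) g‖ ^ 2 ≤
        32 * c / 3 * 4 * (∑ a, w a + W * t) * ‖g‖ ^ 2} ⊆
      {ω | ∃ y ∈ N, ω ∈ {ω | Q ≤ ‖weightedMap w (X · ω) y‖ ^ 2}} := by
    intro ω hω
    by_contra hcon
    refine hω fun g => ?_
    simp only [Set.mem_ofPred_eq, not_exists, not_and, not_le] at hcon
    have h1 := norm_le_of_net le_rfl hN (L := weightedMap w (X · ω)) (Real.sqrt_nonneg Q)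
      (fun y hy => Real.le_sqrt_of_sq_le (hcon y hy).le) g
    calc _ ≤ (2 * √Q * ‖g‖) ^ 2 := by gcongr
      _ = 4 * Q * ‖g‖ ^ 2 := by rw [mul_pow, mul_pow, Real.sq_sqrt hQ0]; ring
      _ ≤ _ := by
        refine mul_le_mul_of_nonneg_right ?_ (sq_nonneg _)
        have : Q = 8 * c / 3 * (∑ a, w a + W * t) := by rw [hQ]; field_simp
        rw [this] at hQ0 ⊢
        nlinarith
  refine (measureReal_mono hsub).trans ((measureReal_exists_mem_le μ N fun y hy =>
    hX.measureReal_upper_tail hc hw0 hwW hW (hN1 y hy) t).trans ?_)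
  gcongr
  refine hNc.trans (le_of_eq ?_)
  norm_num

/-- Lower bound on the smallest singular value of a random matrix with subgaussian entries and
weighted rows, when the total weight is large compared to the number of columns. -/
theorem IsSubgaussianFamily.le_norm_sq (hX : IsSubgaussianFamily X c μ) (hc : 0 < c)
    (hw0 : ∀ a, 0 ≤ w a) (hwW : ∀ a, w a ≤ W) (hW : 0 < W) {ε : ℝ} (hε0 : 0 < ε)
    (hε1 : ε ≤ 1 / 2) (hε2 : ε ^ 2 ≤ 3 / (8 * c) / 64) :
    μ.real {ω | ¬ ∀ g : EuclideanSpace ℝ κ,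
        (∑ a, w a) / 8 * ‖g‖ ^ 2 ≤ ‖weightedMap w (X · ω) g‖ ^ 2} ≤
      (1 + 2 / ε) ^ Fintype.card κ * (Real.exp (-((∑ a, w a) / W)) +
        Real.exp (-((3 / (8 * c)) ^ 2 / 32 * ((∑ a, w a) / W)))) := by
  obtain ⟨N, hN1, hN, hNc⟩ := exists_sphere_net (EuclideanSpace ℝ κ) hε0
  have hc' : (0 : ℝ) < c := hc
  rw [finrank_euclideanSpace] at hNc
  set h : ℝ := 3 / (8 * c) with hh
  have hh0 : 0 < h := by positivity
  set s := ∑ a, w a with hs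
  have hs0 : 0 ≤ s := Finset.sum_nonneg fun a _ => hw0 a
  -- Taking t = s / W makes the upper bound on the net a multiple of s. The condition ε² ≤ h / 64
  -- then keeps the approximation error below half of √(s / 2), which leaves s / 8 after squaring.
  set Q : ℝ := (s + W * (s / W)) / h with hQ
  have hQs : Q = 2 * s / h := by rw [hQ]; field_simp; ring
  have hsub : {ω | ¬ ∀ g : EuclideanSpace ℝ κ, s / 8 * ‖g‖ ^ 2 ≤ ‖weightedMap w (X · ω) g‖ ^ 2} ⊆
      {ω | ∃ y ∈ N, ω ∈ {ω | Q ≤ ‖weightedMap w (X · ω) y‖ ^ 2} ∪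
        {ω | ‖weightedMap w (X · ω) y‖ ^ 2 ≤ s / 2}} := by
    intro ω hω
    by_contra hcon
    refine hω fun g => ?_
    simp only [Set.mem_ofPred_eq, Set.mem_union, not_exists, not_and, not_or, not_le] at hcon
    have h1 := le_norm_of_net hε1 hN (L := weightedMap w (X · ω)) (Real.sqrt_nonneg Q)
      (fun y hy => Real.le_sqrt_of_sq_le (hcon y hy).1.le)
      (A := √(s / 2)) (fun y hy => Real.sqrt_le_iff.2 ⟨norm_nonneg _, (hcon y hy).2.le⟩) g
    have h2 : 2 * √Q * ε ≤ √(s / 2) / 2 := by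
      have : √Q * ε ≤ √(s / 2) / 4 := by
        rw [← Real.sqrt_sq hε0.le, ← Real.sqrt_mul (by rw [hQs]; positivity),
          le_div_iff₀ (by norm_num)]
        refine Real.le_sqrt_of_sq_le ?_
        rw [mul_pow, Real.sq_sqrt (by rw [hQs]; positivity), hQs]
        have : 2 * s / h * ε ^ 2 ≤ 2 * s / h * (h / 64) := by gcongr
        have e : 2 * s / h * (h / 64) = s / 32 := by field_simp; ring
        linarith
      linarith
    have h3 : √(s / 2) / 2 * ‖g‖ ≤ ‖weightedMap w (X · ω) g‖ :=
      (mul_le_mul_of_nonneg_right (by linarith) (norm_nonneg g)).trans h1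
    calc s / 8 * ‖g‖ ^ 2 = (√(s / 2) / 2 * ‖g‖) ^ 2 := by
          rw [mul_pow, div_pow, Real.sq_sqrt (by positivity)]; ring
      _ ≤ _ := by gcongr
  refine (measureReal_mono hsub).trans ((measureReal_exists_mem_le μ N fun y hy =>
    (measureReal_union_le _ _).trans (add_le_add
      (hX.measureReal_upper_tail hc hw0 hwW hW (hN1 y hy) (s / W))
      (hX.measureReal_lower_tail hc hw0 hwW hW (hN1 y hy)))).trans ?_)
  gcongr

end RandomMatrix

/-- With constants depending only on the variance proxy, a random matrix with subgaussian entries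
and weighted rows is bounded below once the total weight exceeds a multiple of the number of
columns. -/
theorem exists_const_le_norm_sq {c : ℝ≥0} (hc : 0 < c) :
    ∃ C : ℝ, 1 ≤ C ∧ ∀ {Ω ι κ : Type} {_ : MeasurableSpace Ω} {μ : Measure Ω}
      [IsProbabilityMeasure μ] [Fintype ι] [Fintype κ] {X : ι × κ → Ω → ℝ} {w : ι → ℝ} {W : ℝ},
      IsSubgaussianFamily X c μ → (∀ a, 0 ≤ w a) → (∀ a, w a ≤ W) → 0 < W →
      C * Fintype.card κ ≤ (∑ a, w a) / W →
      μ.real {ω | ¬ ∀ g : EuclideanSpace ℝ κ,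
          (∑ a, w a) / 8 * ‖g‖ ^ 2 ≤ ‖weightedMap w (X · ω) g‖ ^ 2} ≤
        2 * Real.exp (-((∑ a, w a) / W / C)) := by
  have hc' : (0 : ℝ) < c := hc
  set h : ℝ := 3 / (8 * c) with hh
  have hh0 : 0 < h := by positivity
  set ε : ℝ := min (1 / 2) (√(h / 64)) with hε
  have hε0 : 0 < ε := lt_min (by norm_num) (Real.sqrt_pos.2 (by positivity))
  have hε2 : ε ^ 2 ≤ h / 64 := by
    calc ε ^ 2 ≤ √(h / 64) ^ 2 := by gcongr; exact min_le_right _ _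
      _ = _ := Real.sq_sqrt (by positivity)
  set K : ℝ := 1 + 2 / ε with hK
  have hK1 : 1 ≤ K := by
    have : 0 < 2 / ε := by positivity
    linarith
  have hlK : 0 ≤ Real.log K := Real.log_nonneg hK1
  set a : ℝ := min 1 (h ^ 2 / 32) with ha
  have ha0 : 0 < a := lt_min one_pos (by positivity)
  have ha1 : a ≤ 1 := min_le_left _ _
  have ha2 : a ≤ h ^ 2 / 32 := min_le_right _ _
  -- With this constant the cardinality hypothesis gives |κ| log K ≤ a r / 2: half of the exponent a
  -- r pays for the net, the other half is at least r / C.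
  refine ⟨2 * (Real.log K + 1) / a, ?_, ?_⟩
  · rw [le_div_iff₀ ha0]
    linarith
  intro Ω ι κ _ μ _ _ _ X w W hX hw0 hwW hW hcard
  refine (hX.le_norm_sq hc hw0 hwW hW hε0 (min_le_left _ _) hε2).trans ?_
  set r := (∑ a, w a) / W with hr
  have hr0 : 0 ≤ r := div_nonneg (Finset.sum_nonneg fun a _ => hw0 a) hW.le
  have e1 : Real.exp (-r) ≤ Real.exp (-(a * r)) := by
    rw [Real.exp_le_exp]; nlinarith
  have e2 : Real.exp (-(h ^ 2 / 32 * r)) ≤ Real.exp (-(a * r)) := by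
    rw [Real.exp_le_exp]; nlinarith
  have e3 : (K : ℝ) ^ Fintype.card κ = Real.exp (Fintype.card κ * Real.log K) := by
    rw [Real.exp_nat_mul, Real.exp_log (by linarith)]
  have e4 : (Fintype.card κ : ℝ) * (Real.log K + 1) ≤ a * r / 2 := by
    rw [div_mul_eq_mul_div, div_le_iff₀ ha0] at hcard
    linarith
  have e5 : Real.exp (Fintype.card κ * Real.log K) * Real.exp (-(a * r)) ≤
      Real.exp (-(r / (2 * (Real.log K + 1) / a))) := by
    rw [← Real.exp_add, Real.exp_le_exp]
    have : r / (2 * (Real.log K + 1) / a) ≤ a * r / 2 := by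
      rw [div_div_eq_mul_div, div_le_div_iff₀ (by positivity) (by norm_num)]
      nlinarith [mul_nonneg ha0.le hr0, mul_nonneg (mul_nonneg ha0.le hr0) hlK]
    have hcn : (0 : ℝ) ≤ Fintype.card κ := Nat.cast_nonneg _
    linarith
  calc _ ≤ K ^ Fintype.card κ * (Real.exp (-(a * r)) + Real.exp (-(a * r))) := by gcongr
    _ = 2 * (Real.exp (Fintype.card κ * Real.log K) * Real.exp (-(a * r))) := by rw [e3]; ring
    _ ≤ _ := by gcongr

/-! ### From the regression model to a subgaussian array; the variance formula -/

namespace MNI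

variable {n p : ℕ} {D : Measure ((Fin p → ℝ) × ℝ)} {l θ : Fin p → ℝ} {σ : ℝ}

lemma measurable_whiten (l : Fin p → ℝ) (i : Fin p) :
    Measurable fun q : (Fin p → ℝ) × ℝ => whiten l q.1 i := by
  unfold whiten
  fun_prop

/-- The whitened entries of an i.i.d. sample form an independent subgaussian array. -/
lemma IsLinearRegression.isSubgaussianFamily (h : IsLinearRegression D l θ σ) (n : ℕ) :
    IsSubgaussianFamily (fun (a : Fin n × Fin p) (S : Fin n → (Fin p → ℝ) × ℝ) =>
      whiten l (S a.1).1 a.2) ⟨σ ^ 2, sq_nonneg σ⟩ (Measure.pi fun _ : Fin n => D) := by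
  have := h.isProbabilityMeasure
  have hmp : ∀ j : Fin n, MeasurePreserving (fun S : Fin n → (Fin p → ℝ) × ℝ => S j)
      (Measure.pi fun _ => D) D := fun j => measurePreserving_eval _ j
  have hint : ∀ (j : Fin n) {f : (Fin p → ℝ) × ℝ → ℝ}, Measurable f →
      ∫ S, f (S j) ∂(Measure.pi fun _ : Fin n => D) = ∫ q, f q ∂D := fun j f hf => by
    rw [← (hmp j).map_eq, integral_map (hmp j).measurable.aemeasurable hf.aestronglyMeasurable,
      (hmp j).map_eq]
  have hm := measurable_whiten l
  refine ⟨fun a => (hm a.2).comp (measurable_pi_apply a.1), ?_, fun a => ?_, fun a => ?_,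
    fun a => ?_⟩
  · refine iIndepFun_uncurry' (X := fun j i (S : Fin n → (Fin p → ℝ) × ℝ) => whiten l (S j).1 i)
      (fun j i => (hm i).comp (measurable_pi_apply j)) ?_ fun j => ?_
    · exact iIndepFun_pi (μ := fun _ : Fin n => D)
        (X := fun _ (q : (Fin p → ℝ) × ℝ) (i : Fin p) => whiten l q.1 i)
        fun _ => (measurable_pi_lambda _ hm).aemeasurable
    · have h1 := h.indep_coordinates
      rw [iIndepFun_iff_map_fun_eq_pi_map (fun i => (hm i).aemeasurable)] at h1
      refine (iIndepFun_iff_map_fun_eq_pi_map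
        (f := fun i (S : Fin n → (Fin p → ℝ) × ℝ) => whiten l (S j).1 i)
        (fun i => ((hm i).comp (measurable_pi_apply j)).aemeasurable)).2 ?_
      have e : ∀ {γ : Type} [MeasurableSpace γ] {f : (Fin p → ℝ) × ℝ → γ}, Measurable f →
          (Measure.pi fun _ : Fin n => D).map (fun S => f (S j)) = D.map f := fun {γ} _ f hf => by
        conv_rhs => rw [← (hmp j).map_eq]
        rw [Measure.map_map hf (hmp j).measurable]
        rfl
      rw [e (measurable_pi_lambda _ hm), h1]
      congr 1
      funext i
      exact (e (hm i)).symm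
  · have hsub : HasSubgaussianMGF (fun q : (Fin p → ℝ) × ℝ => whiten l q.1 a.2)
        ⟨σ ^ 2, sq_nonneg σ⟩ D := by
      -- The joint bound is tested on multiples of a basis vector.
      have h1 : ∀ (t : ℝ) (q : (Fin p → ℝ) × ℝ),
          Pi.single a.2 t ⬝ᵥ whiten l q.1 = t * whiten l q.1 a.2 := fun t q => by simp
      have h2 : ∀ t : ℝ, (Pi.single a.2 t : Fin p → ℝ) ⬝ᵥ Pi.single a.2 t = t ^ 2 := fun t => by
        simp [sq]
      refine ⟨fun t => ?_, fun t => ?_⟩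
      · simpa only [h1] using (h.subgaussian (Pi.single a.2 t)).1
      · have := (h.subgaussian (Pi.single a.2 t)).2
        simp only [h1, h2] at this
        exact this
    refine HasSubgaussianMGF.of_map (Y := fun S : Fin n → (Fin p → ℝ) × ℝ => S a.1)
      (X := fun q : (Fin p → ℝ) × ℝ => whiten l q.1 a.2) (hmp a.1).measurable.aemeasurable ?_
    rwa [(hmp a.1).map_eq]
  · rw [hint a.1 (f := fun q => whiten l q.1 a.2) (hm a.2)]
    simp [whiten, integral_div, h.centered]
  · rw [hint a.1 (f := fun q => whiten l q.1 a.2 ^ 2) ((hm a.2).pow_const 2)]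
    have h1 := congrFun (congrFun h.covariance a.2) a.2
    simp only [covMatrix, Matrix.of_apply, Matrix.diagonal_apply_eq] at h1
    have hl := h.eigenvalue_pos a.2
    have h2 : ∀ q : (Fin p → ℝ) × ℝ, whiten l q.1 a.2 ^ 2 = q.1 a.2 * q.1 a.2 / l a.2 :=
      fun q => by rw [whiten, div_pow, Real.sq_sqrt hl.le, sq]
    simp only [h2]
    rw [integral_div, h1, div_self hl.ne']

/-- For a diagonal test covariance, the variance is a weighted sum of squared row norms. -/
lemma IsLinearRegression.variance_diagonal (h : IsLinearRegression D l θ σ) (t : Fin p → ℝ)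
    (X : Matrix (Fin n) (Fin p) ℝ) :
    MNI.variance D θ (Matrix.diagonal t) X = ∑ i, t i * ∑ j, (Xᵀ * (X * Xᵀ)⁻¹) i j ^ 2 := by
  have := h.isProbabilityMeasure
  set N := Xᵀ * (X * Xᵀ)⁻¹ with hN
  have hnm : AEMeasurable (noise θ) D := h.noise_memLp.aestronglyMeasurable.aemeasurable
  set ν := D.map (noise θ) with hν
  have hνp : IsProbabilityMeasure ν := Measure.isProbabilityMeasure_map hnm
  have hV := h.noise_variance_pos
  have hid : MemLp (fun x : ℝ => x) 2 ν :=
    (memLp_map_measure_iff measurable_id'.aestronglyMeasurable hnm).2 h.noise_memLp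
  have hvar : Var[fun x : ℝ => x; ν] = Var[noise θ; D] := by
    rw [hν, variance_map measurable_id'.aemeasurable hnm]
    rfl
  have hmean : ∫ x, x ∂ν = 0 := by
    rw [hν, integral_map hnm measurable_id'.aestronglyMeasurable]
    exact h.noise_centered
  have hL : ∀ i j, MemLp (fun x : ℝ => N i j * x) 2 ν := fun i j => hid.const_mul _
  have hLp : ∀ i j, MemLp (fun ε : Fin n → ℝ => N i j * ε j) 2 (Measure.pi fun _ => ν) :=
    fun i j => (hL i j).comp_measurePreserving (measurePreserving_eval (fun _ : Fin n => ν) j)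
  have hS : ∀ i, MemLp (fun ε : Fin n → ℝ => ∑ j, N i j * ε j) 2 (Measure.pi fun _ => ν) :=
    fun i => memLp_finsetSum _ fun j _ => hLp i j
  have hsq : ∀ i, ∫ ε : Fin n → ℝ, (∑ j, N i j * ε j) ^ 2 ∂(Measure.pi fun _ => ν) =
      (∑ j, N i j ^ 2) * Var[noise θ; D] := by
    intro i
    have h0 : ∫ ε : Fin n → ℝ, ∑ j, N i j * ε j ∂(Measure.pi fun _ => ν) = 0 := by
      rw [integral_finsetSum _ fun j _ => (hLp i j).integrable (by norm_num)]
      refine Finset.sum_eq_zero fun j _ => ?_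
      rw [integral_const_mul]
      have := measurePreserving_eval (fun _ : Fin n => ν) j
      have h1 := integral_map (μ := Measure.pi fun _ : Fin n => ν) (φ := fun ε : Fin n → ℝ => ε j)
        (f := fun x : ℝ => x) (measurable_pi_apply j).aemeasurable
        measurable_id'.aestronglyMeasurable
      rw [show Measure.map (fun ε : Fin n → ℝ => ε j) (Measure.pi fun _ : Fin n => ν) = ν from
        this.map_eq] at h1
      rw [← h1, hmean, mul_zero]
    have h1 := variance_sum_pi (fun j => hL i j)
    have h2 : (∑ j, fun ω : Fin n → ℝ => N i j * ω j) = fun ε => ∑ j, N i j * ε j := by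
      ext ε
      simp
    rw [h2, variance_of_integral_eq_zero (hS i).aestronglyMeasurable.aemeasurable h0] at h1
    rw [h1, Finset.sum_mul]
    refine Finset.sum_congr rfl fun j _ => ?_
    rw [variance_const_mul, hvar]
  have hrisk : ∀ ε : Fin n → ℝ, noiseRisk (Matrix.diagonal t) X ε =
      ∑ i, t i * (∑ j, N i j * ε j) ^ 2 := by
    intro ε
    have hm : mni X ε = N *ᵥ ε := by rw [mni, Matrix.mulVec_mulVec, hN]
    rw [noiseRisk, hm, dotProduct]
    refine Finset.sum_congr rfl fun i _ => ?_
    rw [Matrix.mulVec_diagonal, Matrix.mulVec, dotProduct]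
    ring
  rw [MNI.variance]
  simp only [hrisk]
  rw [integral_div, integral_finsetSum _ fun i _ => ((hS i).integrable_sq).const_mul (t i),
    Finset.sum_div]
  refine Finset.sum_congr rfl fun i _ => ?_
  rw [integral_const_mul, hsq i]
  field_simp

/-- The vector of the `i`-th whitened feature over the sample. -/
noncomputable def featureVec (l : Fin p → ℝ) (S : Fin n → (Fin p → ℝ) × ℝ) (i : Fin p) :
    EuclideanSpace ℝ (Fin n) :=
  WithLp.toLp 2 fun j => whiten l (S j).1 i

open scoped InnerProductSpace in
/-- When the sample Gram matrix is positive definite, the variances for diagonal test covariances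
are determined by the solutions `y i` of the linear systems with right-hand sides `z i`. -/
lemma IsLinearRegression.exists_variance_eq (h : IsLinearRegression D l θ σ)
    (S : Fin n → (Fin p → ℝ) × ℝ) {κ : ℝ} (hκ : 0 < κ)
    (hlow : ∀ v, κ * ‖v‖ ^ 2 ≤ ∑ i, l i * ⟪featureVec l S i, v⟫_ℝ ^ 2) :
    ∃ y : Fin p → EuclideanSpace ℝ (Fin n),
      (∀ i, ∑ j, (l j * ⟪featureVec l S j, y i⟫_ℝ) • featureVec l S j = featureVec l S i) ∧
      ∀ t : Fin p → ℝ, MNI.variance D θ (Matrix.diagonal t) (dataMatrix S) =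
        ∑ i, t i * l i * ‖y i‖ ^ 2 := by
  set X := dataMatrix S with hX
  set A := X * Xᵀ with hA
  set z := featureVec l S with hz
  have hXe : ∀ j i, X j i = √(l i) * z i j := fun j i => by
    have := Real.sqrt_pos.2 (h.eigenvalue_pos i)
    simp only [hX, hz, dataMatrix, featureVec, whiten, Matrix.of_apply]
    field_simp
  have hinner : ∀ (u v : EuclideanSpace ℝ (Fin n)), ⟪u, v⟫_ℝ = ∑ j, u j * v j := fun u v => by
    rw [PiLp.inner_apply]
    exact Finset.sum_congr rfl fun j _ => by simp [mul_comm]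
  have hAv : ∀ v : EuclideanSpace ℝ (Fin n), ∀ j,
      (A *ᵥ (v : Fin n → ℝ)) j = (∑ i, (l i * ⟪z i, v⟫_ℝ) • z i : EuclideanSpace ℝ (Fin n)) j := by
    intro v j
    have e1 : ∀ i, (Xᵀ *ᵥ (v : Fin n → ℝ)) i = √(l i) * ⟪z i, v⟫_ℝ := fun i => by
      rw [hinner, Finset.mul_sum, Matrix.mulVec, dotProduct]
      exact Finset.sum_congr rfl fun k _ => by rw [Matrix.transpose_apply, hXe]; ring
    rw [hA, ← Matrix.mulVec_mulVec, Matrix.mulVec, dotProduct, WithLp.ofLp_sum, Finset.sum_apply]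
    refine Finset.sum_congr rfl fun i _ => ?_
    rw [e1, hXe, WithLp.ofLp_smul, Pi.smul_apply, smul_eq_mul]
    have := Real.mul_self_sqrt (h.eigenvalue_pos i).le
    linear_combination (z i j * ⟪z i, v⟫_ℝ) * this
  have hquad : ∀ v : EuclideanSpace ℝ (Fin n),
      (v : Fin n → ℝ) ⬝ᵥ (A *ᵥ (v : Fin n → ℝ)) = ∑ i, l i * ⟪z i, v⟫_ℝ ^ 2 := fun v => by
    have e : (v : Fin n → ℝ) ⬝ᵥ (A *ᵥ (v : Fin n → ℝ)) =
        ⟪∑ i, (l i * ⟪z i, v⟫_ℝ) • z i, v⟫_ℝ := by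
      rw [hinner, dotProduct]
      exact Finset.sum_congr rfl fun j _ => by rw [hAv, mul_comm]
    rw [e, sum_inner]
    exact Finset.sum_congr rfl fun i _ => by rw [real_inner_smul_left]; ring
  -- For a singular matrix `⁻¹` would be the default value 0; the lower bound on the quadratic form
  -- makes A injective and excludes this.
  have hunit : IsUnit A := by
    rw [← Matrix.mulVec_injective_iff_isUnit]
    refine (injective_iff_map_eq_zero A.mulVecLin).2 fun v hv => ?_
    have h1 := hlow (WithLp.toLp 2 v)
    rw [← hquad] at h1
    have h2 : A *ᵥ v = 0 := hv
    simp only [h2, dotProduct_zero] at h1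
    have h3 : ‖(WithLp.toLp 2 v : EuclideanSpace ℝ (Fin n))‖ = 0 := by
      have := norm_nonneg (WithLp.toLp 2 v : EuclideanSpace ℝ (Fin n))
      by_contra hne
      have : 0 < ‖(WithLp.toLp 2 v : EuclideanSpace ℝ (Fin n))‖ := lt_of_le_of_ne this (Ne.symm hne)
      have : 0 < κ * ‖(WithLp.toLp 2 v : EuclideanSpace ℝ (Fin n))‖ ^ 2 := by positivity
      linarith
    rw [norm_eq_zero] at h3
    simpa using congrArg WithLp.ofLp h3
  have hdet : IsUnit A.det := (Matrix.isUnit_iff_isUnit_det A).1 hunit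
  have hsymm : A⁻¹ᵀ = A⁻¹ := by
    rw [Matrix.transpose_nonsing_inv, hA, Matrix.transpose_mul, Matrix.transpose_transpose]
  -- Since A is symmetric, row i of Xᵀ A⁻¹ is √(λ_i) y_i.
  refine ⟨fun i => WithLp.toLp 2 (A⁻¹ *ᵥ (z i : Fin n → ℝ)), fun i => ?_, fun t => ?_⟩
  · ext j
    rw [← hAv]
    simp only
    rw [Matrix.mulVec_mulVec, Matrix.mul_nonsing_inv _ hdet, Matrix.one_mulVec]
  · rw [h.variance_diagonal]
    refine Finset.sum_congr rfl fun i _ => ?_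
    rw [mul_assoc, EuclideanSpace.real_norm_sq_eq, Finset.mul_sum _ _ (l i)]
    congr 1
    refine Finset.sum_congr rfl fun j _ => ?_
    have e : (Xᵀ * A⁻¹) i j = √(l i) * (A⁻¹ *ᵥ (z i : Fin n → ℝ)) j := by
      rw [Matrix.mul_apply, Matrix.mulVec, dotProduct, Finset.mul_sum]
      refine Finset.sum_congr rfl fun k _ => ?_
      have := congrFun (congrFun hsymm j) k
      rw [Matrix.transpose_apply] at this
      rw [Matrix.transpose_apply, hXe, this]
      ring
    rw [← hA, e, mul_pow, Real.sq_sqrt (h.eigenvalue_pos i).le]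

end MNI

/-! ### Deterministic bounds for solutions of Gram systems -/

section Deterministic

open scoped InnerProductSpace

variable {E ι : Type*} [NormedAddCommGroup E] [InnerProductSpace ℝ E]
  {z : ι → E} {l : ι → ℝ}

lemma inner_gram_left (s : Finset ι) (z : ι → E) (l : ι → ℝ) (u v : E) :
    ⟪∑ i ∈ s, (l i * ⟪z i, u⟫_ℝ) • z i, v⟫_ℝ = ∑ i ∈ s, l i * ⟪z i, u⟫_ℝ * ⟪z i, v⟫_ℝ := by
  rw [sum_inner]
  exact Finset.sum_congr rfl fun i _ => real_inner_smul_left _ _ _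

/-- Cauchy–Schwarz for the bilinear form of a weighted Gram operator bounded by `L`. -/
lemma gram_bilin_le (hl : ∀ i, 0 ≤ l i) {s : Finset ι} {L : ℝ} (hL0 : 0 ≤ L)
    (hL : ∀ v, ∑ i ∈ s, l i * ⟪z i, v⟫_ℝ ^ 2 ≤ L * ‖v‖ ^ 2) (u v : E) :
    ∑ i ∈ s, l i * ⟪z i, u⟫_ℝ * ⟪z i, v⟫_ℝ ≤ L * ‖u‖ * ‖v‖ := by
  have h1 := Finset.sum_mul_sq_le_sq_mul_sq s (fun i => √(l i) * ⟪z i, u⟫_ℝ)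
    (fun i => √(l i) * ⟪z i, v⟫_ℝ)
  have e1 : ∀ w : E, ∑ i ∈ s, (√(l i) * ⟪z i, w⟫_ℝ) ^ 2 = ∑ i ∈ s, l i * ⟪z i, w⟫_ℝ ^ 2 :=
    fun w => Finset.sum_congr rfl fun i _ => by rw [mul_pow, Real.sq_sqrt (hl i)]
  have e2 : ∑ i ∈ s, √(l i) * ⟪z i, u⟫_ℝ * (√(l i) * ⟪z i, v⟫_ℝ) =
      ∑ i ∈ s, l i * ⟪z i, u⟫_ℝ * ⟪z i, v⟫_ℝ := Finset.sum_congr rfl fun i _ => by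
    have := Real.mul_self_sqrt (hl i)
    linear_combination ⟪z i, u⟫_ℝ * ⟪z i, v⟫_ℝ * this
  rw [e1, e1, e2] at h1
  refine abs_le_of_sq_le_sq' ?_ (by positivity) |>.2
  refine h1.trans ?_
  have h0 : ∀ w : E, 0 ≤ ∑ i ∈ s, l i * ⟪z i, w⟫_ℝ ^ 2 :=
    fun w => Finset.sum_nonneg fun i _ => mul_nonneg (hl i) (sq_nonneg _)
  calc _ ≤ (L * ‖u‖ ^ 2) * (L * ‖v‖ ^ 2) :=
        mul_le_mul (hL u) (hL v) (h0 v) (by positivity)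
    _ = _ := by ring

variable [Fintype ι]

/-- If the Gram operator is at least `κ`, its inverse is at most `κ⁻¹`. -/
lemma norm_solution_le {κ : ℝ}
    (hlow : ∀ v, κ * ‖v‖ ^ 2 ≤ ∑ i, l i * ⟪z i, v⟫_ℝ ^ 2) {x y : E}
    (hy : ∑ j, (l j * ⟪z j, y⟫_ℝ) • z j = x) : κ * ‖y‖ ≤ ‖x‖ := by
  rcases (norm_nonneg y).eq_or_lt with h0 | h0
  · rw [← h0, mul_zero]
    exact norm_nonneg _
  have h1 := hlow y
  have h2 : ∑ i, l i * ⟪z i, y⟫_ℝ ^ 2 = ⟪x, y⟫_ℝ := by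
    rw [← hy, inner_gram_left]
    exact Finset.sum_congr rfl fun i _ => by ring
  have h3 := real_inner_le_norm x y
  refine le_of_mul_le_mul_right ?_ h0
  nlinarith

variable [DecidableEq ι]

/-- The solution of `A y = x` is bounded below by the distance of `x` from the span of the `z j`,
`j ∈ s`, divided by a bound for the part of `A` indexed by the complement of `s`. -/
lemma le_norm_solution (hl : ∀ i, 0 ≤ l i) {s : Finset ι} {L d : ℝ} (hL0 : 0 ≤ L)
    (hL : ∀ v, ∑ i ∈ sᶜ, l i * ⟪z i, v⟫_ℝ ^ 2 ≤ L * ‖v‖ ^ 2) {x y : E}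
    (hy : ∑ j, (l j * ⟪z j, y⟫_ℝ) • z j = x)
    (hd : ∀ g : ι → ℝ, d ≤ ‖x - ∑ j ∈ s, g j • z j‖) : d ≤ L * ‖y‖ := by
  -- Pair A y = x with the component v of x orthogonal to the z j, j ∈ s. The terms from s vanish,
  -- and ‖v‖² = ⟪x, v⟫ ≤ L ‖y‖ ‖v‖.
  let K : Submodule ℝ E := Submodule.span ℝ (z '' s)
  have : FiniteDimensional ℝ K := FiniteDimensional.span_of_finite ℝ (s.finite_toSet.image z)
  set v := x - K.starProjection x with hv
  have hvK : v ∈ Kᗮ := Submodule.sub_starProjection_mem_orthogonal x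
  have hPK : K.starProjection x ∈ K := Submodule.starProjection_apply_mem K x
  obtain ⟨g, hg⟩ : ∃ g : ι → ℝ, ∑ j ∈ s, g j • z j = K.starProjection x := by
    obtain ⟨c, hc⟩ := (Submodule.mem_span_image_finset_iff_exists_fun ℝ).1 hPK
    refine ⟨fun j => if h : j ∈ s then c ⟨j, h⟩ else 0, ?_⟩
    rw [← hc, ← Finset.sum_coe_sort s]
    exact Finset.sum_congr rfl fun j _ => by simp
  have hdv : d ≤ ‖v‖ := by
    have := hd g
    rwa [hg] at this
  refine hdv.trans ?_
  rcases (norm_nonneg v).eq_or_lt with h0 | h0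
  · rw [← h0]
    positivity
  have horth : ∀ j ∈ s, ⟪z j, v⟫_ℝ = 0 := fun j hj =>
    (Submodule.mem_orthogonal K v).1 hvK _ (Submodule.subset_span ⟨j, hj, rfl⟩)
  have h1 : ⟪x, v⟫_ℝ = ‖v‖ ^ 2 := by
    have e : x = v + K.starProjection x := by rw [hv]; abel
    conv_lhs => rw [e]
    rw [inner_add_left, real_inner_self_eq_norm_sq,
      (Submodule.mem_orthogonal K v).1 hvK _ hPK, add_zero]
  have h2 : ⟪x, v⟫_ℝ = ∑ i ∈ sᶜ, l i * ⟪z i, y⟫_ℝ * ⟪z i, v⟫_ℝ := by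
    rw [← hy, inner_gram_left, ← Finset.sum_add_sum_compl s]
    rw [Finset.sum_eq_zero fun j hj => by rw [horth j hj, mul_zero], zero_add]
  have h3 := gram_bilin_le hl hL0 hL y v
  rw [← h2, h1] at h3
  refine le_of_mul_le_mul_right ?_ h0
  linarith [sq ‖v‖]

/-- Upper bound for the solutions with right-hand side `z i`, `i ∈ s`, when the part of the Gram
operator outside `s` is between `κ` and `L` and the `z j`, `j ∈ s`, are well-conditioned. -/
lemma norm_head_solution_sq_le (hl : ∀ i, 0 < l i) {s : Finset ι} {κ L m : ℝ} (hκ : 0 < κ)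
    (hm : 0 < m) (hL0 : 0 ≤ L)
    (hlow : ∀ v, κ * ‖v‖ ^ 2 ≤ ∑ i ∈ sᶜ, l i * ⟪z i, v⟫_ℝ ^ 2)
    (hL : ∀ v, ∑ i ∈ sᶜ, l i * ⟪z i, v⟫_ℝ ^ 2 ≤ L * ‖v‖ ^ 2)
    (hms : ∀ g : ι → ℝ, m * ∑ j ∈ s, g j ^ 2 ≤ ‖∑ j ∈ s, g j • z j‖ ^ 2)
    {i : ι} (hi : i ∈ s) {y : E} (hy : ∑ j, (l j * ⟪z j, y⟫_ℝ) • z j = z i) :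
    l i ^ 2 * ‖y‖ ^ 2 ≤ L / (κ * m) := by
  -- The system becomes M = ∑_{j ∈ s} g_j z_j, where M is the tail operator applied to w. With q =
  -- ⟪M, w⟫ one has q ≤ g_i, hence m q² ≤ m ∑ g_j² ≤ ‖M‖² ≤ L q. Thus q ≤ L / m, and κ ‖w‖² ≤ q
  -- concludes; the l j with j ∈ s drop out.
  set w := l i • y with hw
  set M := ∑ j ∈ sᶜ, (l j * ⟪z j, w⟫_ℝ) • z j with hM
  set g : ι → ℝ := fun j => l j * ((if j = i then 1 else 0) - ⟪z j, w⟫_ℝ) with hg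
  have hwn : ‖w‖ ^ 2 = l i ^ 2 * ‖y‖ ^ 2 := by
    rw [hw, norm_smul, mul_pow, Real.norm_eq_abs, sq_abs]
  have hMg : M = ∑ j ∈ s, g j • z j := by
    have h1 : ∑ j, (l j * ⟪z j, w⟫_ℝ) • z j = l i • z i := by
      rw [← hy, Finset.smul_sum]
      refine Finset.sum_congr rfl fun j _ => ?_
      rw [hw, real_inner_smul_right, smul_smul]
      congr 1
      ring
    rw [← Finset.sum_add_sum_compl s, ← eq_sub_iff_add_eq'] at h1
    rw [hM, h1]
    have h2 : l i • z i = ∑ j ∈ s, (if j = i then l j else 0) • z j := by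
      simp [ite_smul, hi]
    rw [h2, ← Finset.sum_sub_distrib]
    refine Finset.sum_congr rfl fun j _ => ?_
    rw [← sub_smul]
    congr 1
    simp only [hg]
    split_ifs <;> ring
  have hq : ⟪M, w⟫_ℝ = ∑ j ∈ sᶜ, l j * ⟪z j, w⟫_ℝ ^ 2 := by
    rw [hM, inner_gram_left]
    exact Finset.sum_congr rfl fun j _ => by ring
  set q := ⟪M, w⟫_ℝ with hqdef
  set G := ∑ j ∈ s, g j ^ 2 with hG
  have hq0 : 0 ≤ q := hq ▸ Finset.sum_nonneg fun j _ => mul_nonneg (hl j).le (sq_nonneg _)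
  have hqg : q ≤ g i := by
    have h1 : q = ∑ j ∈ s, g j * ⟪z j, w⟫_ℝ := by
      rw [hqdef, hMg, sum_inner]
      exact Finset.sum_congr rfl fun j _ => real_inner_smul_left _ _ _
    -- For j ≠ i the left side is -l_j ⟪z_j, w⟫²; for j = i the difference of the two sides is l_i
    -- (1 - ⟪z_i, w⟫)².
    have h2 : ∀ j, g j * ⟪z j, w⟫_ℝ ≤ if j = i then g j else 0 := fun j => by
      have h3 : g j = l j * ((if j = i then 1 else 0) - ⟪z j, w⟫_ℝ) := rfl
      have hlj := hl j
      split_ifs at h3 ⊢ with hji <;> rw [h3] <;>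
        nlinarith [mul_nonneg hlj.le (sq_nonneg (1 - ⟪z j, w⟫_ℝ)),
          mul_nonneg hlj.le (sq_nonneg ⟪z j, w⟫_ℝ)]
    rw [h1]
    refine (Finset.sum_le_sum fun j _ => h2 j).trans (le_of_eq ?_)
    simp [hi]
  have hgG : g i ^ 2 ≤ G := Finset.single_le_sum (f := fun j => g j ^ 2)
    (fun j _ => sq_nonneg _) hi
  -- The operator inequality B² ≤ L B for 0 ≤ B ≤ L, evaluated at w.
  have hMq : ‖M‖ ^ 2 ≤ L * q := by
    rcases (norm_nonneg M).eq_or_lt with h0 | h0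
    · rw [← h0]
      simpa using mul_nonneg hL0 hq0
    have h1 : ‖M‖ ^ 2 = ∑ j ∈ sᶜ, (√(l j) * ⟪z j, w⟫_ℝ) * (√(l j) * ⟪z j, M⟫_ℝ) := by
      rw [← real_inner_self_eq_norm_sq]
      conv_lhs => rw [hM]
      rw [inner_gram_left]
      refine Finset.sum_congr rfl fun j _ => ?_
      have := Real.mul_self_sqrt (hl j).le
      linear_combination -(⟪z j, w⟫_ℝ * ⟪z j, M⟫_ℝ) * this
    have h2 := Finset.sum_mul_sq_le_sq_mul_sq sᶜ (fun j => √(l j) * ⟪z j, w⟫_ℝ)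
      (fun j => √(l j) * ⟪z j, M⟫_ℝ)
    have e1 : ∀ u : E, ∑ j ∈ sᶜ, (√(l j) * ⟪z j, u⟫_ℝ) ^ 2 = ∑ j ∈ sᶜ, l j * ⟪z j, u⟫_ℝ ^ 2 :=
      fun u => Finset.sum_congr rfl fun j _ => by rw [mul_pow, Real.sq_sqrt (hl j).le]
    rw [← h1, e1, e1, ← hq] at h2
    have h3 : (‖M‖ ^ 2) ^ 2 ≤ q * (L * ‖M‖ ^ 2) := h2.trans (mul_le_mul_of_nonneg_left (hL M) hq0)
    have h4 : 0 < ‖M‖ ^ 2 := by positivity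
    refine le_of_mul_le_mul_right ?_ h4
    nlinarith
  have hGM : m * G ≤ L * q := by
    have := hms g
    rw [← hMg] at this
    exact this.trans hMq
  have hqL : m * q ≤ L := by
    rcases hq0.eq_or_lt with h0 | h0
    · rw [← h0, mul_zero]
      exact hL0
    refine le_of_mul_le_mul_right ?_ h0
    have : q ^ 2 ≤ G := (pow_le_pow_left₀ hq0 hqg 2).trans hgG
    nlinarith
  rw [le_div_iff₀ (by positivity), ← hwn]
  have := hlow w
  rw [← hq] at this
  nlinarith

end Deterministic

/-! ### Averaging over unlikely bad events -/

open Classical in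
/-- If each of the events `B i` is unlikely, then most of the weight is usually carried by indices
whose event does not occur. -/
lemma measureReal_good_weight_lt_le {Ω ι : Type*} {mΩ : MeasurableSpace Ω} {μ : Measure Ω}
    [IsProbabilityMeasure μ] {s : Finset ι} {B : ι → Set Ω} {w : ι → ℝ} {δ : ℝ} (hδ : 0 ≤ δ)
    (hw : ∀ i, 0 ≤ w i) (hB : ∀ i ∈ s, μ.real (B i) ≤ δ) :
    μ.real {ω | ∑ i ∈ s with ω ∉ B i, w i < (∑ i ∈ s, w i) / 2} ≤ 2 * δ := by
  set T := ∑ i ∈ s, w i with hT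
  rcases (Finset.sum_nonneg fun i (_ : i ∈ s) => hw i).eq_or_lt with h0 | h0
  · have : {ω | ∑ i ∈ s with ω ∉ B i, w i < T / 2} = ∅ := by
      ext ω
      simp only [Set.mem_ofPred_eq, Set.mem_empty_iff_false, iff_false, not_lt]
      rw [hT, ← h0, zero_div]
      exact Finset.sum_nonneg fun i _ => hw i
    rw [this, measureReal_empty]
    positivity
  -- Markov's inequality for the total bad weight, whose mean is at most δ T. Measurable hulls are
  -- used because the B i need not be measurable.
  let f : Ω → ℝ := fun ω => ∑ i ∈ s, w i * (toMeasurable μ (B i)).indicator (fun _ => 1) ω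
  have hfi : ∀ i, Integrable (fun ω => w i * (toMeasurable μ (B i)).indicator (fun _ => 1) ω) μ :=
    fun i => ((integrable_const (1 : ℝ)).indicator (measurableSet_toMeasurable μ _)).const_mul _
  have hf0 : ∀ ω, 0 ≤ f ω := fun ω => Finset.sum_nonneg fun i _ =>
    mul_nonneg (hw i) (Set.indicator_nonneg (fun _ _ => zero_le_one) _)
  have hint : ∫ ω, f ω ∂μ ≤ δ * T := by
    rw [integral_finsetSum _ fun i _ => hfi i, hT, Finset.mul_sum]
    refine Finset.sum_le_sum fun i hi => ?_
    rw [integral_const_mul, integral_indicator (measurableSet_toMeasurable μ _), mul_comm δ]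
    refine mul_le_mul_of_nonneg_left ?_ (hw i)
    simp only [integral_const, smul_eq_mul, mul_one, MeasurableSet.univ, measureReal_restrict_apply,
      Set.univ_inter]
    rw [measureReal_def, measure_toMeasurable]
    exact hB i hi
  have hsub : {ω | ∑ i ∈ s with ω ∉ B i, w i < T / 2} ⊆ {ω | T / 2 ≤ f ω} := by
    intro ω hω
    have h1 := Finset.sum_filter_add_sum_filter_not s (fun i => ω ∈ B i) w
    have h2 : ∑ i ∈ s with ω ∈ B i, w i ≤ f ω := by
      rw [Finset.sum_filter]
      refine Finset.sum_le_sum fun i _ => ?_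
      split_ifs with h
      · rw [Set.indicator_of_mem (subset_toMeasurable μ _ h), mul_one]
      · exact mul_nonneg (hw i) (Set.indicator_nonneg (fun _ _ => zero_le_one) _)
    simp only [Set.mem_ofPred_eq] at hω ⊢
    linarith
  have hM := mul_meas_ge_le_integral_of_nonneg (ae_of_all μ hf0)
    (integrable_finsetSum _ fun i _ => hfi i) (T / 2)
  have h3 := measureReal_mono (μ := μ) hsub
  refine h3.trans ?_
  refine le_of_mul_le_mul_left ?_ (half_pos h0)
  calc _ ≤ δ * T := hM.trans hint
    _ = _ := by ring

/-! ### High-probability bounds for head and tail features -/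

namespace MNI

open scoped InnerProductSpace

/-- The indices of the top `k` features. -/
def headSet (p k : ℕ) : Finset (Fin p) := {i | i.val < k}

@[simp] lemma mem_headSet {p k : ℕ} {i : Fin p} : i ∈ headSet p k ↔ i.val < k := by simp [headSet]

lemma card_headSet_le (p k : ℕ) : (headSet p k).card ≤ k := by
  have : (headSet p k).card ≤ (Finset.range k).card :=
    Finset.card_le_card_of_injOn (fun i => i.val) (fun i hi => by simpa using hi)
      (fun i _ j _ h => Fin.ext h)
  simpa using this

lemma sum_compl_headSet {p : ℕ} (f : Fin p → ℝ) (k : ℕ) :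
    ∑ i ∈ (headSet p k)ᶜ, f i = ∑ i, if k ≤ i.val then f i else 0 := by
  rw [← Finset.sum_filter]
  congr 1
  ext i
  simp

lemma tailSum_eq {p : ℕ} (l : Fin p → ℝ) (k : ℕ) : tailSum l k = ∑ i ∈ (headSet p k)ᶜ, l i :=
  (sum_compl_headSet l k).symm

variable {n p : ℕ} {D : Measure ((Fin p → ℝ) × ℝ)} {l θ : Fin p → ℝ} {σ : ℝ}

lemma inner_featureVec (S : Fin n → (Fin p → ℝ) × ℝ) (i : Fin p) (v : EuclideanSpace ℝ (Fin n)) :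
    ⟪featureVec l S i, v⟫_ℝ = ∑ j, whiten l (S j).1 i * v j := by
  rw [PiLp.inner_apply]
  exact Finset.sum_congr rfl fun j _ => by simp [featureVec, mul_comm]

/-- The weights `l i` of the tail features, extended by zero. -/
noncomputable def tailWeight (l : Fin p → ℝ) (k : ℕ) (i : Fin p) : ℝ :=
  if k ≤ i.val then l i else 0

lemma tailWeight_nonneg (hl : ∀ i, 0 < l i) (k : ℕ) (i : Fin p) : 0 ≤ tailWeight l k i := by
  unfold tailWeight
  split_ifs
  exacts [(hl i).le, le_rfl]

lemma tailWeight_le (hl : ∀ i, 0 < l i) (ha : Antitone l) {k : ℕ} (hk : k < p) (i : Fin p) :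
    tailWeight l k i ≤ l ⟨k, hk⟩ := by
  unfold tailWeight
  split_ifs with h
  exacts [ha h, (hl _).le]

lemma norm_sq_tail (hl : ∀ i, 0 < l i) (k : ℕ) (S : Fin n → (Fin p → ℝ) × ℝ)
    (v : EuclideanSpace ℝ (Fin n)) :
    ‖weightedMap (tailWeight l k) (fun a : Fin p × Fin n => whiten l (S a.2).1 a.1) v‖ ^ 2 =
      ∑ i ∈ (headSet p k)ᶜ, l i * ⟪featureVec l S i, v⟫_ℝ ^ 2 := by
  rw [norm_sq_weightedMap (tailWeight_nonneg hl k), sum_compl_headSet]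
  refine Finset.sum_congr rfl fun i _ => ?_
  rw [inner_featureVec, tailWeight]
  split_ifs <;> simp

/-- Since 5 ≤ e², a 1/2-net in dimension d ≤ n costs at most e^(2n). This is why the deviation level
is 3n below. -/
lemma five_pow_mul_exp_le {d : ℕ} (hd : d ≤ n) :
    (5 : ℝ) ^ d * Real.exp (-(3 * n)) ≤ Real.exp (-n) := by
  have h5 : (5 : ℝ) ≤ Real.exp 2 := by
    have := Real.exp_one_gt_d9
    rw [show (2 : ℝ) = 1 + 1 by norm_num, Real.exp_add]
    nlinarith
  have h1 : (5 : ℝ) ^ d ≤ Real.exp (2 * n) := by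
    calc (5 : ℝ) ^ d ≤ 5 ^ n := pow_le_pow_right₀ (by norm_num) hd
      _ ≤ Real.exp 2 ^ n := by gcongr
      _ = Real.exp (2 * n) := by rw [← Real.exp_nat_mul, mul_comm]
  calc _ ≤ Real.exp (2 * n) * Real.exp (-(3 * n)) := by gcongr
    _ = _ := by rw [← Real.exp_add]; congr 1; ring

lemma proxy_pos (hσ : 0 < σ) : 0 < (⟨σ ^ 2, sq_nonneg σ⟩ : ℝ≥0) :=
  show (0 : ℝ) < σ ^ 2 from pow_pos hσ 2

/-- The array is transposed: features are the weighted rows and observations the columns. The net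
then lives in R^n, and p enters only through the sum of the weights. -/
lemma IsLinearRegression.tail_form_le (h : IsLinearRegression D l θ σ) (hσ : 0 < σ) (n : ℕ)
    {k : ℕ} (hk : k < p) :
    (Measure.pi fun _ : Fin n => D).real {S | ¬ ∀ v,
      ∑ i ∈ (headSet p k)ᶜ, l i * ⟪featureVec l S i, v⟫_ℝ ^ 2 ≤
        32 * σ ^ 2 / 3 * 4 * (tailSum l k + l ⟨k, hk⟩ * (3 * n)) * ‖v‖ ^ 2} ≤ Real.exp (-n) := by
  have := h.isProbabilityMeasure
  have hX := (h.isSubgaussianFamily n).precomp (Prod.swap_injective (α := Fin p) (β := Fin n))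
  have h1 := hX.norm_sq_le (proxy_pos hσ)
    (tailWeight_nonneg h.eigenvalue_pos k)
    (tailWeight_le h.eigenvalue_pos h.eigenvalue_antitone hk) (h.eigenvalue_pos _)
    (t := 3 * n) (by positivity)
  simp only [Prod.fst_swap, Prod.snd_swap, norm_sq_tail h.eigenvalue_pos] at h1
  refine h1.trans ?_
  rw [Fintype.card_fin]
  exact five_pow_mul_exp_le le_rfl

/-- Each feature vector is the image of a basis vector under one matrix with |s| columns, so a
single norm bound controls all of them. -/
lemma IsLinearRegression.norm_sq_featureVec_le (h : IsLinearRegression D l θ σ) (hσ : 0 < σ)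
    {s : Finset (Fin p)} (hs : s.card ≤ n) :
    (Measure.pi fun _ : Fin n => D).real {S | ¬ ∀ i ∈ s,
      ‖featureVec l S i‖ ^ 2 ≤ 32 * σ ^ 2 / 3 * 4 * (n + 3 * n)} ≤ Real.exp (-n) := by
  have := h.isProbabilityMeasure
  have hX := (h.isSubgaussianFamily n).precomp (κ := Fin n × s) (g := fun a => (a.1, a.2.1))
    fun _ _ hab => Prod.ext (Prod.ext_iff.1 hab).1 (Subtype.ext (Prod.ext_iff.1 hab).2)
  have h1 := hX.norm_sq_le (w := fun _ => 1) (W := 1)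
    (proxy_pos hσ) (fun _ => zero_le_one)
    (fun _ => le_rfl) one_pos (t := 3 * n) (by positivity)
  refine (measureReal_mono ?_).trans (h1.trans ?_)
  · intro S hS hcon
    refine hS fun i hi => ?_
    have h2 := hcon (PiLp.single 2 ⟨i, hi⟩ (1 : ℝ))
    rw [norm_sq_weightedMap fun _ => zero_le_one] at h2
    simp only [PiLp.norm_single, norm_one, one_pow, mul_one, one_mul, Finset.sum_const,
      Finset.card_univ, Fintype.card_fin, nsmul_eq_mul, PiLp.single_apply, mul_ite,
      mul_zero, Finset.sum_ite_eq', Finset.mem_univ, if_true] at h2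
    rw [EuclideanSpace.real_norm_sq_eq]
    exact h2
  · rw [Fintype.card_coe]
    exact five_pow_mul_exp_le hs

/-- All entries form a single column, with weight λ_i² on tail entries and 0 on head entries, so the
net costs only a factor 5. The deviation term n λ_{k+1}² is at most n times the tail sum of squares.
-/
lemma IsLinearRegression.tail_trace_le (h : IsLinearRegression D l θ σ) (hσ : 0 < σ) (n : ℕ)
    {k : ℕ} (hk : k < p) :
    (Measure.pi fun _ : Fin n => D).real {S | ¬
      ∑ i ∈ (headSet p k)ᶜ, l i ^ 2 * ‖featureVec l S i‖ ^ 2 ≤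
        32 * σ ^ 2 / 3 * 4 * (2 * n * tailSum (fun i => l i ^ 2) k)} ≤ 5 * Real.exp (-n) := by
  have := h.isProbabilityMeasure
  have hX := (h.isSubgaussianFamily n).precomp (κ := (Fin n × Fin p) × Unit) (g := fun a => a.1)
    (by rintro ⟨a, b⟩ ⟨c, d⟩ h; simpa using h)
  have hl2 : ∀ i, 0 < l i ^ 2 := fun i => pow_pos (h.eigenvalue_pos i) 2
  have ha2 : Antitone fun i => l i ^ 2 := fun i j hij =>
    pow_le_pow_left₀ (h.eigenvalue_pos j).le (h.eigenvalue_antitone hij) 2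
  have hw0 : ∀ a : Fin n × Fin p, 0 ≤ tailWeight (fun i => l i ^ 2) k a.2 :=
    fun a => tailWeight_nonneg hl2 k a.2
  have h1 := hX.norm_sq_le (proxy_pos hσ) hw0
    (fun a => tailWeight_le hl2 ha2 hk a.2) (hl2 _) (t := n) (by positivity)
  refine (measureReal_mono ?_).trans (h1.trans (by simp))
  intro S hS hcon
  refine hS ?_
  have h2 := hcon (PiLp.single 2 () (1 : ℝ))
  rw [norm_sq_weightedMap hw0] at h2
  simp only [Finset.univ_unique, PUnit.default_eq_unit, Finset.sum_singleton] at h2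
  simp only [PiLp.norm_single, norm_one, one_pow, mul_one, PiLp.single_apply, if_true,
    Fintype.sum_prod_type, Finset.sum_const, Finset.card_univ, Fintype.card_fin,
    nsmul_eq_mul] at h2
  have e1 : ∑ i ∈ (headSet p k)ᶜ, l i ^ 2 * ‖featureVec l S i‖ ^ 2 =
      ∑ j, ∑ i, tailWeight (fun i => l i ^ 2) k i * whiten l (S j).1 i ^ 2 := by
    rw [sum_compl_headSet, Finset.sum_comm]
    refine Finset.sum_congr rfl fun i _ => ?_
    rw [EuclideanSpace.real_norm_sq_eq, tailWeight]
    split_ifs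
    · rw [Finset.mul_sum]
      rfl
    · simp
  have e2 : ∑ i, tailWeight (fun i => l i ^ 2) k i = tailSum (fun i => l i ^ 2) k := rfl
  have e3 : l ⟨k, hk⟩ ^ 2 ≤ tailSum (fun i => l i ^ 2) k := by
    rw [tailSum_eq]
    exact Finset.single_le_sum (f := fun i => l i ^ 2) (fun i _ => (hl2 i).le) (by simp)
  rw [e1]
  refine h2.trans ?_
  rw [e2]
  change 32 * σ ^ 2 / 3 * 4 * _ ≤ _
  have : (0 : ℝ) ≤ n := Nat.cast_nonneg n
  refine mul_le_mul_of_nonneg_left ?_ (by positivity)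
  nlinarith

/-- Lower bounds for the tail Gram operator and for the conditioning of few features, with a
constant depending only on the subgaussian parameter. -/
lemma exists_const_lower_bounds (hσ : 0 < σ) :
    ∃ C : ℝ, 1 ≤ C ∧ ∀ {n p : ℕ} {D : Measure ((Fin p → ℝ) × ℝ)} {l θ : Fin p → ℝ},
      IsLinearRegression D l θ σ →
      (∀ k, C ≤ rho n l k → (Measure.pi fun _ : Fin n => D).real {S | ¬ ∀ v,
          tailSum l k / 8 * ‖v‖ ^ 2 ≤
            ∑ i ∈ (headSet p k)ᶜ, l i * ⟪featureVec l S i, v⟫_ℝ ^ 2} ≤ 2 * Real.exp (-(n / C))) ∧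
      (∀ s : Finset (Fin p), C * s.card ≤ n → (Measure.pi fun _ : Fin n => D).real {S | ¬ ∀ g : Fin p → ℝ,
          n / 8 * ∑ j ∈ s, g j ^ 2 ≤ ‖∑ j ∈ s, g j • featureVec l S j‖ ^ 2} ≤
            2 * Real.exp (-(n / C))) := by
  obtain ⟨C, hC1, hC⟩ := exists_const_le_norm_sq (proxy_pos hσ)
  refine ⟨C, hC1, fun {n p D l θ} h => ⟨fun k hk => ?_, fun s hs => ?_⟩⟩
  · have := h.isProbabilityMeasure
    have hkp : k < p := by
      by_contra hkp
      rw [rho, dif_neg hkp] at hk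
      linarith
    rw [rho, dif_pos hkp] at hk
    have hl := h.eigenvalue_pos ⟨k, hkp⟩
    have hn : (0 : ℝ) < n := by
      rcases Nat.eq_zero_or_pos n with rfl | hn
      · simp at hk
        linarith
      · exact_mod_cast hn
    rw [le_div_iff₀ (by positivity)] at hk
    have hX := (h.isSubgaussianFamily n).precomp (Prod.swap_injective (α := Fin p) (β := Fin n))
    have hr : C * n ≤ tailSum l k / l ⟨k, hkp⟩ := by
      rw [le_div_iff₀ hl]
      linarith
    have h1 := hC hX (tailWeight_nonneg h.eigenvalue_pos k)
      (tailWeight_le h.eigenvalue_pos h.eigenvalue_antitone hkp) hl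
      (by rw [Fintype.card_fin]; exact hr)
    simp only [Prod.fst_swap, Prod.snd_swap, norm_sq_tail h.eigenvalue_pos] at h1
    refine h1.trans ?_
    have h2 : (n : ℝ) ≤ tailSum l k / l ⟨k, hkp⟩ := by nlinarith
    have h3 : (n : ℝ) / C ≤ tailSum l k / l ⟨k, hkp⟩ / C := by gcongr
    have e : (∑ a, tailWeight l k a) = tailSum l k := rfl
    rw [e]
    gcongr
  · have := h.isProbabilityMeasure
    have hX := (h.isSubgaussianFamily n).precomp (κ := Fin n × s) (g := fun a => (a.1, a.2.1))
      fun _ _ hab => Prod.ext (Prod.ext_iff.1 hab).1 (Subtype.ext (Prod.ext_iff.1 hab).2)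
    have h1 := hC hX (w := fun _ => 1) (W := 1) (fun _ => zero_le_one) (fun _ => le_rfl) one_pos
      (by simpa using hs)
    simp only [Finset.sum_const, Finset.card_univ, Fintype.card_fin, nsmul_eq_mul, mul_one,
      div_one] at h1
    refine (measureReal_mono ?_).trans h1
    intro S hS hcon
    refine hS fun g => ?_
    have h2 := hcon (WithLp.toLp 2 fun j : s => g j)
    rw [norm_sq_weightedMap fun _ => zero_le_one, EuclideanSpace.real_norm_sq_eq] at h2
    simp only [one_mul] at h2
    rw [Finset.sum_coe_sort s fun j => g j ^ 2] at h2
    refine h2.trans (le_of_eq ?_)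
    rw [EuclideanSpace.real_norm_sq_eq]
    refine Finset.sum_congr rfl fun a _ => ?_
    congr 1
    rw [Finset.sum_coe_sort s fun j => whiten l (S a).1 j * g j, WithLp.ofLp_sum, Finset.sum_apply]
    exact Finset.sum_congr rfl fun j _ => by simp [featureVec, mul_comm]

end MNI

/-! ### Head and tail parts of the variance -/

namespace MNI

open scoped InnerProductSpace

/-- The combination with coefficient 1 at i and -g_j elsewhere has squared coefficient norm at least
1. Conditioning thus bounds the distance from z_i to the span of the others. -/
lemma le_norm_sub_sq_of_wellConditioned {E ι : Type*} [NormedAddCommGroup E]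
    [InnerProductSpace ℝ E] [DecidableEq ι] {z : ι → E} {s : Finset ι} {m : ℝ} (hm : 0 ≤ m)
    (hms : ∀ g : ι → ℝ, m * ∑ j ∈ s, g j ^ 2 ≤ ‖∑ j ∈ s, g j • z j‖ ^ 2) {i : ι} (hi : i ∈ s)
    (g : ι → ℝ) : √m ≤ ‖z i - ∑ j ∈ s.erase i, g j • z j‖ := by
  have h1 := hms fun j => if j = i then 1 else -g j
  rw [← Finset.add_sum_erase s _ hi, ← Finset.add_sum_erase s _ hi] at h1
  simp only [if_true, one_smul, one_pow] at h1
  have h2 : ∑ j ∈ s.erase i, (if j = i then 1 else -g j) • z j = -∑ j ∈ s.erase i, g j • z j := by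
    rw [← Finset.sum_neg_distrib]
    exact Finset.sum_congr rfl fun j hj => by rw [if_neg (Finset.ne_of_mem_erase hj), neg_smul]
  rw [h2, ← sub_eq_add_neg] at h1
  have h3 : 0 ≤ ∑ j ∈ s.erase i, (if j = i then 1 else -g j) ^ 2 :=
    Finset.sum_nonneg fun j _ => sq_nonneg _
  refine Real.sqrt_le_iff.2 ⟨norm_nonneg _, ?_⟩
  nlinarith

variable {n p : ℕ} {D : Measure ((Fin p → ℝ) × ℝ)} {l θ : Fin p → ℝ} {σ : ℝ}

/-- The change of the variance at `X` is `(α - 1) H + (β - 1) T` for all shift factors. -/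
def ShiftGap (D : Measure ((Fin p → ℝ) × ℝ)) (l θ : Fin p → ℝ) (k : ℕ)
    (X : Matrix (Fin n) (Fin p) ℝ) (H T : ℝ) : Prop :=
  ∀ α β : ℝ, MNI.variance D θ (shiftedCov l k α β) X - MNI.variance D θ (covMatrix D) X =
    (α - 1) * H + (β - 1) * T

/-- `y i` solves the linear system of the sample Gram operator with right-hand side `z i`. -/
def IsGramSolution (l : Fin p → ℝ) (S : Fin n → (Fin p → ℝ) × ℝ)
    (y : Fin p → EuclideanSpace ℝ (Fin n)) : Prop :=
  ∀ i, ∑ j, (l j * ⟪featureVec l S j, y i⟫_ℝ) • featureVec l S j = featureVec l S i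

/-- The contribution of the features in `s` to the variance. -/
noncomputable def partVariance (l : Fin p → ℝ) (y : Fin p → EuclideanSpace ℝ (Fin n))
    (s : Finset (Fin p)) : ℝ :=
  ∑ i ∈ s, l i ^ 2 * ‖y i‖ ^ 2

lemma IsLinearRegression.tailSum_pos (h : IsLinearRegression D l θ σ) {k : ℕ} (hk : k < p) :
    0 < tailSum l k := by
  rw [tailSum_eq]
  exact Finset.sum_pos (fun i _ => h.eigenvalue_pos i) ⟨⟨k, hk⟩, by simp⟩

lemma IsLinearRegression.exists_shiftGap (h : IsLinearRegression D l θ σ)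
    (S : Fin n → (Fin p → ℝ) × ℝ) {k : ℕ} (hk : k < p)
    (hlow : ∀ v, tailSum l k / 8 * ‖v‖ ^ 2 ≤
      ∑ i ∈ (headSet p k)ᶜ, l i * ⟪featureVec l S i, v⟫_ℝ ^ 2) :
    ∃ y, IsGramSolution l S y ∧ ShiftGap D l θ k (dataMatrix S)
      (partVariance l y (headSet p k)) (partVariance l y (headSet p k)ᶜ) ∧
      ∀ i, tailSum l k / 8 * ‖y i‖ ≤ ‖featureVec l S i‖ := by
  have hpos := h.tailSum_pos hk
  have hlow' : ∀ v, tailSum l k / 8 * ‖v‖ ^ 2 ≤ ∑ i, l i * ⟪featureVec l S i, v⟫_ℝ ^ 2 :=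
    fun v => (hlow v).trans (Finset.sum_le_sum_of_subset_of_nonneg (Finset.subset_univ _)
      fun i _ _ => mul_nonneg (h.eigenvalue_pos i).le (sq_nonneg _))
  obtain ⟨y, hy, hV⟩ := h.exists_variance_eq S (κ := tailSum l k / 8) (by positivity) hlow'
  refine ⟨y, hy, fun α β => ?_, fun i => norm_solution_le hlow' (hy i)⟩
  rw [h.covariance, shiftedCov, hV, hV, ← Finset.sum_sub_distrib, partVariance, partVariance,
    Finset.mul_sum, Finset.mul_sum, ← Finset.sum_add_sum_compl (headSet p k)]
  congr 1 <;> refine Finset.sum_congr rfl fun i hi => ?_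
  · rw [if_pos (mem_headSet.1 hi)]
    ring
  · rw [if_neg (by simpa using hi)]
    ring

lemma partVariance_pos {y : Fin p → EuclideanSpace ℝ (Fin n)} (hl : ∀ i, 0 < l i)
    {S : Fin n → (Fin p → ℝ) × ℝ} (hy : IsGramSolution l S y) {s : Finset (Fin p)} {i : Fin p}
    (hi : i ∈ s) (hz : featureVec l S i ≠ 0) : 0 < partVariance l y s := by
  have hyi : y i ≠ 0 := fun h0 => hz (by rw [← hy i, h0]; simp)
  have : 0 < l i ^ 2 * ‖y i‖ ^ 2 :=
    mul_pos (pow_pos (hl i) 2) (pow_pos (norm_pos_iff.2 hyi) 2)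
  exact this.trans_le (Finset.single_le_sum (f := fun i => l i ^ 2 * ‖y i‖ ^ 2)
    (fun i _ => by positivity) hi)

lemma partVariance_head_le {y : Fin p → EuclideanSpace ℝ (Fin n)} (hl : ∀ i, 0 < l i)
    {S : Fin n → (Fin p → ℝ) × ℝ} (hy : IsGramSolution l S y) {k : ℕ} {κ L m : ℝ} (hκ : 0 < κ)
    (hm : 0 < m) (hL0 : 0 ≤ L)
    (hlow : ∀ v, κ * ‖v‖ ^ 2 ≤ ∑ i ∈ (headSet p k)ᶜ, l i * ⟪featureVec l S i, v⟫_ℝ ^ 2)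
    (hL : ∀ v, ∑ i ∈ (headSet p k)ᶜ, l i * ⟪featureVec l S i, v⟫_ℝ ^ 2 ≤ L * ‖v‖ ^ 2)
    (hms : ∀ g : Fin p → ℝ, m * ∑ j ∈ headSet p k, g j ^ 2 ≤
      ‖∑ j ∈ headSet p k, g j • featureVec l S j‖ ^ 2) :
    partVariance l y (headSet p k) ≤ k * (L / (κ * m)) := by
  have h1 := Finset.sum_le_card_nsmul (headSet p k) (fun i => l i ^ 2 * ‖y i‖ ^ 2) _
    fun i hi => norm_head_solution_sq_le hl hκ hm hL0 hlow hL hms hi (hy i)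
  rw [nsmul_eq_mul] at h1
  refine h1.trans (mul_le_mul_of_nonneg_right ?_ (by positivity))
  exact_mod_cast card_headSet_le p k

/-- For i in G the vector z_i is at distance at least √m from the span of the head, so ‖y_i‖ ≥ √m /
L. Restricting to G allows for a few badly placed tail features. -/
lemma le_partVariance_tail {y : Fin p → EuclideanSpace ℝ (Fin n)} (hl : ∀ i, 0 < l i)
    {S : Fin n → (Fin p → ℝ) × ℝ} (hy : IsGramSolution l S y) {k : ℕ} {L m Q : ℝ}
    (hm : 0 ≤ m) (hL0 : 0 < L)
    (hL : ∀ v, ∑ i ∈ (headSet p k)ᶜ, l i * ⟪featureVec l S i, v⟫_ℝ ^ 2 ≤ L * ‖v‖ ^ 2)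
    {G : Finset (Fin p)} (hG : G ⊆ (headSet p k)ᶜ)
    (hms : ∀ i ∈ G, ∀ g : Fin p → ℝ, m * ∑ j ∈ insert i (headSet p k), g j ^ 2 ≤
      ‖∑ j ∈ insert i (headSet p k), g j • featureVec l S j‖ ^ 2)
    (hQ : Q ≤ ∑ i ∈ G, l i ^ 2) : Q * (m / L ^ 2) ≤ partVariance l y (headSet p k)ᶜ := by
  have h1 : ∀ i ∈ G, m / L ^ 2 ≤ ‖y i‖ ^ 2 := by
    intro i hi
    have h2 := le_norm_sub_sq_of_wellConditioned hm (hms i hi) (Finset.mem_insert_self i _)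
    rw [Finset.erase_insert (Finset.mem_compl.1 (hG hi))] at h2
    have h3 := le_norm_solution (fun i => (hl i).le) hL0.le hL (hy i) h2
    rw [div_le_iff₀ (by positivity), ← Real.sq_sqrt hm]
    calc _ ≤ (L * ‖y i‖) ^ 2 := by gcongr
      _ = _ := by ring
  calc Q * (m / L ^ 2) ≤ (∑ i ∈ G, l i ^ 2) * (m / L ^ 2) :=
        mul_le_mul_of_nonneg_right hQ (by positivity)
    _ = ∑ i ∈ G, l i ^ 2 * (m / L ^ 2) := Finset.sum_mul _ _ _
    _ ≤ ∑ i ∈ G, l i ^ 2 * ‖y i‖ ^ 2 :=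
        Finset.sum_le_sum fun i hi => mul_le_mul_of_nonneg_left (h1 i hi) (sq_nonneg _)
    _ ≤ _ := Finset.sum_le_sum_of_subset_of_nonneg hG fun i _ _ => by positivity

/-- For i among the first m features, the other m - 1 are projected out. What remains is λ_i z_i
z_iᵀ plus the tail beyond m, of norm at most λ_i M, and this λ_i cancels the weight λ_i². The index
m may be below k because conditioning is available only for few features. -/
lemma le_partVariance_head {y : Fin p → EuclideanSpace ℝ (Fin n)} (hl : ∀ i, 0 < l i)
    {S : Fin n → (Fin p → ℝ) × ℝ} (hy : IsGramSolution l S y) {k m : ℕ} (hmk : m ≤ k)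
    (hmp : m ≤ p) {L B d M : ℝ} (hd : 0 ≤ d) (hM0 : 0 < M)
    (hL : ∀ v, ∑ i ∈ (headSet p m)ᶜ, l i * ⟪featureVec l S i, v⟫_ℝ ^ 2 ≤ L * ‖v‖ ^ 2)
    (hB : ∀ i ∈ headSet p m, ‖featureVec l S i‖ ^ 2 ≤ B)
    (hM : ∀ i ∈ headSet p m, l i * B + L ≤ l i * M)
    (hms : ∀ g : Fin p → ℝ, d * ∑ j ∈ headSet p m, g j ^ 2 ≤
      ‖∑ j ∈ headSet p m, g j • featureVec l S j‖ ^ 2) :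
    m * (d / M ^ 2) ≤ partVariance l y (headSet p k) := by
  have h1 : ∀ i ∈ headSet p m, d / M ^ 2 ≤ l i ^ 2 * ‖y i‖ ^ 2 := by
    intro i hi
    have h2 := le_norm_sub_sq_of_wellConditioned hd hms hi
    have hform : ∀ v, ∑ j ∈ ((headSet p m).erase i)ᶜ, l j * ⟪featureVec l S j, v⟫_ℝ ^ 2 ≤
        (l i * M) * ‖v‖ ^ 2 := by
      intro v
      rw [Finset.compl_erase, Finset.sum_insert (by simpa using hi)]
      have h4 : ⟪featureVec l S i, v⟫_ℝ ^ 2 ≤ B * ‖v‖ ^ 2 := by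
        have := abs_real_inner_le_norm (featureVec l S i) v
        calc _ = |⟪featureVec l S i, v⟫_ℝ| ^ 2 := (sq_abs _).symm
          _ ≤ (‖featureVec l S i‖ * ‖v‖) ^ 2 := by gcongr
          _ = ‖featureVec l S i‖ ^ 2 * ‖v‖ ^ 2 := mul_pow _ _ _
          _ ≤ _ := mul_le_mul_of_nonneg_right (hB i hi) (sq_nonneg _)
      calc _ ≤ l i * (B * ‖v‖ ^ 2) + L * ‖v‖ ^ 2 :=
            add_le_add (mul_le_mul_of_nonneg_left h4 (hl i).le) (hL v)
        _ = (l i * B + L) * ‖v‖ ^ 2 := by ring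
        _ ≤ _ := mul_le_mul_of_nonneg_right (hM i hi) (sq_nonneg _)
    have h3 := le_norm_solution (fun i => (hl i).le) (mul_pos (hl i) hM0).le hform (hy i) h2
    rw [div_le_iff₀ (by positivity), ← Real.sq_sqrt hd]
    calc _ ≤ (l i * M * ‖y i‖) ^ 2 := by gcongr
      _ = _ := by ring
  have hcard : (headSet p m).card = m := by
    have : headSet p m = (Finset.univ : Finset (Fin m)).map (Fin.castLEEmb hmp) := by
      ext i
      simp only [mem_headSet, Finset.mem_map, Finset.mem_univ, true_and]
      exact ⟨fun hi => ⟨⟨i, hi⟩, rfl⟩, by rintro ⟨a, rfl⟩; exact a.2⟩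
    rw [this]
    simp
  have h5 := Finset.card_nsmul_le_sum (headSet p m) _ _ h1
  rw [hcard, nsmul_eq_mul] at h5
  refine h5.trans (Finset.sum_le_sum_of_subset_of_nonneg (fun i hi => ?_)
    fun i _ _ => by positivity)
  rw [mem_headSet] at hi ⊢
  omega

/-- Only monotonicity and subadditivity are used, so neither event has to be measurable. -/
lemma one_sub_le_sampleProb [IsProbabilityMeasure D] {E : Matrix (Fin n) (Fin p) ℝ → Prop}
    {B : Set (Fin n → (Fin p → ℝ) × ℝ)} {δ : ℝ} (hδ : (Measure.pi fun _ : Fin n => D).real B ≤ δ)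
    (hB : ∀ S, S ∉ B → E (dataMatrix S)) : 1 - δ ≤ sampleProb n D E := by
  have h1 : (Set.univ : Set (Fin n → (Fin p → ℝ) × ℝ)) ⊆ B ∪ {S | E (dataMatrix S)} := fun S _ => by
    by_cases h : S ∈ B
    exacts [Or.inl h, Or.inr (hB S h)]
  have h2 := (measureReal_mono (μ := Measure.pi fun _ : Fin n => D) h1).trans
    (measureReal_union_le _ _)
  rw [probReal_univ] at h2
  rw [sampleProb]
  linarith

lemma sampleProb_mono [IsProbabilityMeasure D] {E F : Matrix (Fin n) (Fin p) ℝ → Prop}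
    (h : ∀ X, E X → F X) : sampleProb n D E ≤ sampleProb n D F :=
  measureReal_mono fun S hS => h _ hS

end MNI

/-! ### Two-sided control of the head and tail parts with high probability -/

namespace MNI

open scoped InnerProductSpace

variable {n p : ℕ} {D : Measure ((Fin p → ℝ) × ℝ)} {l θ : Fin p → ℝ} {σ : ℝ}

/-- High-probability lower bounds for the tail Gram operator and for the conditioning of few
features, with constant `C`. -/
structure HasLowerBounds (D : Measure ((Fin p → ℝ) × ℝ)) (l : Fin p → ℝ) (n : ℕ) (C : ℝ) :
    Prop where
  one_le : 1 ≤ C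
  tail : ∀ k, C ≤ rho n l k → (Measure.pi fun _ : Fin n => D).real {S | ¬ ∀ v,
    tailSum l k / 8 * ‖v‖ ^ 2 ≤
      ∑ i ∈ (headSet p k)ᶜ, l i * ⟪featureVec l S i, v⟫_ℝ ^ 2} ≤ 2 * Real.exp (-(n / C))
  head : ∀ s : Finset (Fin p), C * s.card ≤ n →
    (Measure.pi fun _ : Fin n => D).real {S | ¬ ∀ g : Fin p → ℝ,
      n / 8 * ∑ j ∈ s, g j ^ 2 ≤ ‖∑ j ∈ s, g j • featureVec l S j‖ ^ 2} ≤
        2 * Real.exp (-(n / C))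

lemma HasLowerBounds.exp_neg_le {C : ℝ} (hb : HasLowerBounds D l n C) :
    Real.exp (-n) ≤ Real.exp (-(n / C)) := by
  rw [Real.exp_le_exp, neg_le_neg_iff]
  exact div_le_self (Nat.cast_nonneg n) hb.one_le

lemma lt_of_one_le_rho {k : ℕ} {C : ℝ} (hC : 1 ≤ C) (hk : C ≤ rho n l k) : k < p := by
  by_contra h
  rw [rho, dif_neg h] at hk
  linarith

lemma pos_of_one_le_rho {k : ℕ} {C : ℝ} (hC : 1 ≤ C) (hk : C ≤ rho n l k) : 0 < n := by
  rcases Nat.eq_zero_or_pos n with rfl | hn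
  · rw [rho, dif_pos (lt_of_one_le_rho hC hk)] at hk
    simp at hk
    linarith
  · exact hn

/-- Both parts of the variance are positive with high probability. -/
lemma IsLinearRegression.prob_parts_pos (h : IsLinearRegression D l θ σ) {C : ℝ}
    (hb : HasLowerBounds D l n C) {k : ℕ} (hk1 : 1 ≤ k) (hk : C ≤ rho n l k) (hn : C ≤ n) :
    1 - 6 * Real.exp (-(n / C)) ≤ sampleProb n D fun X =>
      ∃ H T, ShiftGap D l θ k X H T ∧ 0 < H ∧ 0 < T := by
  have := h.isProbabilityMeasure
  have hkp := lt_of_one_le_rho hb.one_le hk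
  have hn0 : (0 : ℝ) < n := Nat.cast_pos.2 (pos_of_one_le_rho hb.one_le hk)
  have h1 := hb.tail k hk
  have h2 := fun i : Fin p => hb.head {i} (by simpa using hn)
  set B1 := {S : Fin n → (Fin p → ℝ) × ℝ | ¬ ∀ v, tailSum l k / 8 * ‖v‖ ^ 2 ≤
    ∑ i ∈ (headSet p k)ᶜ, l i * ⟪featureVec l S i, v⟫_ℝ ^ 2} with hB1
  set B2 : Fin p → Set (Fin n → (Fin p → ℝ) × ℝ) := fun i => {S | ¬ ∀ g : Fin p → ℝ,
    n / 8 * ∑ j ∈ {i}, g j ^ 2 ≤ ‖∑ j ∈ {i}, g j • featureVec l S j‖ ^ 2} with hB2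
  -- One nonzero feature per block suffices: the 0-based index 0 is in the head since k ≥ 1, and k
  -- is the first tail index.
  have hB : (Measure.pi fun _ : Fin n => D).real (B1 ∪ B2 ⟨0, by omega⟩ ∪ B2 ⟨k, hkp⟩) ≤ _ :=
    (measureReal_union_le _ _).trans (add_le_add ((measureReal_union_le _ _).trans
      (add_le_add h1 (h2 _))) (h2 _))
  refine le_trans ?_ (one_sub_le_sampleProb hB fun S hS => ?_)
  · linarith
  · simp only [Set.mem_union, not_or] at hS
    obtain ⟨⟨hS1, hS2⟩, hS3⟩ := hS
    obtain ⟨y, hy, hgap, -⟩ := h.exists_shiftGap S hkp (not_not.1 hS1)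
    have hne : ∀ i, S ∉ B2 i → featureVec l S i ≠ 0 := fun i hi h0 => by
      have := not_not.1 hi fun _ => 1
      simp only [Finset.sum_singleton, h0, smul_zero, norm_zero] at this
      norm_num at this
      linarith
    exact ⟨_, _, hgap, partVariance_pos h.eigenvalue_pos hy (by simp; omega) (hne _ hS2),
      partVariance_pos h.eigenvalue_pos hy (by simp) (hne _ hS3)⟩

lemma mul_eigenvalue_le_tailSum (h : IsLinearRegression D l θ σ) {k : ℕ} {b : ℝ} (hb1 : 1 ≤ b)
    (hk : b ≤ rho n l k) (hkp : k < p) : b * (n * l ⟨k, hkp⟩) ≤ tailSum l k := by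
  have hn0 : (0 : ℝ) < n := Nat.cast_pos.2 (pos_of_one_le_rho hb1 hk)
  rw [rho, dif_pos hkp, le_div_iff₀ (mul_pos hn0 (h.eigenvalue_pos _))] at hk
  exact hk

lemma tailSum_sq_pos (h : IsLinearRegression D l θ σ) {k : ℕ} (hk : k < p) :
    0 < tailSum (fun i => l i ^ 2) k := by
  rw [tailSum_eq]
  exact Finset.sum_pos (fun i _ => pow_pos (h.eigenvalue_pos i) 2) ⟨⟨k, hk⟩, by simp⟩

open Classical in
/-- For most of the tail weight, a tail feature is well-conditioned relative to the head. -/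
lemma IsLinearRegression.prob_conditioned_tail (h : IsLinearRegression D l θ σ) {C : ℝ}
    (hb : HasLowerBounds D l n C) {k : ℕ} (hn : C * (k + 1) ≤ n) :
    (Measure.pi fun _ : Fin n => D).real {S | ¬ ∃ G ⊆ (headSet p k)ᶜ,
      (∀ i ∈ G, ∀ g : Fin p → ℝ, n / 8 * ∑ j ∈ insert i (headSet p k), g j ^ 2 ≤
        ‖∑ j ∈ insert i (headSet p k), g j • featureVec l S j‖ ^ 2) ∧
      tailSum (fun i => l i ^ 2) k / 2 ≤ ∑ i ∈ G, l i ^ 2} ≤ 4 * Real.exp (-(n / C)) := by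
  have := h.isProbabilityMeasure
  set B : Fin p → Set (Fin n → (Fin p → ℝ) × ℝ) := fun i => {S | ¬ ∀ g : Fin p → ℝ,
    n / 8 * ∑ j ∈ insert i (headSet p k), g j ^ 2 ≤
      ‖∑ j ∈ insert i (headSet p k), g j • featureVec l S j‖ ^ 2} with hB
  have hC0 : 0 ≤ C := zero_le_one.trans hb.one_le
  have hcard : ∀ i, C * ((insert i (headSet p k)).card : ℝ) ≤ n := fun i => by
    refine le_trans (mul_le_mul_of_nonneg_left ?_ hC0) hn
    have h1 := (Finset.card_insert_le i (headSet p k)).trans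
      (Nat.add_le_add_right (card_headSet_le p k) 1)
    exact_mod_cast h1
  -- Replaces a union bound over the tail indices, which would bring in p; only a factor 2 is lost.
  have h1 := measureReal_good_weight_lt_le (μ := Measure.pi fun _ : Fin n => D)
    (s := (headSet p k)ᶜ) (B := B) (w := fun i => l i ^ 2) (δ := 2 * Real.exp (-(n / C)))
    (by positivity) (fun i => sq_nonneg _) fun i _ => hb.head _ (hcard i)
  refine (measureReal_mono fun S hS => ?_).trans (h1.trans (by linarith))
  by_contra hcon
  refine hS ⟨{i ∈ (headSet p k)ᶜ | S ∉ B i}, Finset.filter_subset _ _, fun i hi => ?_, ?_⟩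
  · exact not_not.1 (Finset.mem_filter.1 hi).2
  · rw [tailSum_eq]
    rw [Set.mem_ofPred_eq, not_lt] at hcon
    convert! hcon

/-- With few head features, the head part of the variance is at most of order `k / n` and the tail
part is at least of order `n / R_k`. -/
lemma IsLinearRegression.prob_head_le_tail_ge (h : IsLinearRegression D l θ σ) (hσ : 0 < σ) {C : ℝ}
    (hb : HasLowerBounds D l n C) {k : ℕ} (hk : C ≤ rho n l k) (hn : C * (k + 1) ≤ n) :
    1 - 9 * Real.exp (-(n / C)) ≤ sampleProb n D fun X =>
      ∃ H T, ShiftGap D l θ k X H T ∧ H ≤ 256 * (32 * σ ^ 2 / 3 * 4) * (k / n) ∧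
        n / effRank l k ≤ 256 * (32 * σ ^ 2 / 3 * 4) ^ 2 * T := by
  have := h.isProbabilityMeasure
  have hkp := lt_of_one_le_rho hb.one_le hk
  have hn0 : (0 : ℝ) < n := Nat.cast_pos.2 (pos_of_one_le_rho hb.one_le hk)
  have hs0 := h.tailSum_pos hkp
  have hls := mul_eigenvalue_le_tailSum h le_rfl (hb.one_le.trans hk) hkp
  have h1 := hb.tail k hk
  have h2 := h.tail_form_le hσ n hkp
  have h3 := hb.head (headSet p k) (le_trans (mul_le_mul_of_nonneg_left
    (by exact_mod_cast (card_headSet_le p k).trans (Nat.le_succ k)) (zero_le_one.trans hb.one_le))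
    hn)
  have h4 := h.prob_conditioned_tail hb hn
  set U : ℝ := 32 * σ ^ 2 / 3 * 4 with hU
  have hU0 : 0 < U := by positivity
  set s := tailSum l k with hs
  set Q := tailSum (fun i => l i ^ 2) k with hQ
  have hB := (measureReal_union_le _ _).trans (add_le_add ((measureReal_union_le _ _).trans
    (add_le_add ((measureReal_union_le _ _).trans (add_le_add h1 h2)) h3)) h4)
  refine le_trans ?_ (one_sub_le_sampleProb hB fun S hS => ?_)
  · linarith [hb.exp_neg_le]
  · simp only [Set.mem_union, not_or] at hS
    obtain ⟨⟨⟨hS1, hS2⟩, hS3⟩, hS4⟩ := hS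
    replace hS1 := not_not.1 hS1
    replace hS2 := not_not.1 hS2
    replace hS3 := not_not.1 hS3
    obtain ⟨G, hG, hGc, hGQ⟩ := not_not.1 hS4
    -- ρ_k ≥ 1 means n λ_{k+1} ≤ s, so s + 3 n λ_{k+1} ≤ 4 s.
    have hL : ∀ v, ∑ i ∈ (headSet p k)ᶜ, l i * ⟪featureVec l S i, v⟫_ℝ ^ 2 ≤
        (4 * U * s) * ‖v‖ ^ 2 := fun v => (hS2 v).trans (mul_le_mul_of_nonneg_right
      (by nlinarith) (sq_nonneg _))
    obtain ⟨y, hy, hgap, -⟩ := h.exists_shiftGap S hkp hS1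
    refine ⟨_, _, hgap, ?_, ?_⟩
    · refine (partVariance_head_le h.eigenvalue_pos hy (by positivity : 0 < s / 8)
        (by positivity : (0 : ℝ) < n / 8) (by positivity) hS1 hL hS3).trans (le_of_eq ?_)
      field_simp
      ring
    · have h5 := le_partVariance_tail h.eigenvalue_pos hy (by positivity : (0 : ℝ) ≤ n / 8)
        (by positivity) hL hG hGc hGQ
      have e : Q / 2 * (n / 8 / (4 * U * s) ^ 2) = n / effRank l k / (256 * U ^ 2) := by
        rw [effRank, ← hs, ← hQ]
        field_simp
        ring
      rw [e, div_le_iff₀ (by positivity)] at h5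
      linarith

/-- When `k` is the least index at which `ρ` reaches `b`, the head part of the variance is at least
of order `k / n` and the tail part is at most of order `n / R_k`. -/
lemma IsLinearRegression.prob_head_ge_tail_le (h : IsLinearRegression D l θ σ) (hσ : 0 < σ)
    {C b : ℝ} (hb : HasLowerBounds D l n C) {k : ℕ} (hCb : C ≤ b) (hk1 : 1 ≤ k) (hkn : k ≤ n)
    (hk : IsLeast {j | b ≤ rho n l j} k) (hn : C ≤ n) :
    1 - 11 * Real.exp (-(n / C)) ≤ sampleProb n D fun X =>
      ∃ H T, ShiftGap D l θ k X H T ∧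
        k / n ≤ 16 * C * (32 * σ ^ 2 / 3 * 4) ^ 2 * (7 + b) ^ 2 * H ∧
        T ≤ 128 * (32 * σ ^ 2 / 3 * 4) * (n / effRank l k) := by
  have := h.isProbabilityMeasure
  have hC1 := hb.one_le
  have hC0 : 0 < C := by linarith
  have hkC : C ≤ rho n l k := hCb.trans hk.1
  have hkp := lt_of_one_le_rho hC1 hkC
  have hn0 : (0 : ℝ) < n := Nat.cast_pos.2 (pos_of_one_le_rho hC1 hkC)
  have hs0 := h.tailSum_pos hkp
  -- m = min(k, ⌊n / C⌋): few enough features for the conditioning bound, yet a constant fraction of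
  -- k because k ≤ n.
  obtain ⟨m, hm1, hmk, hmC, hmn⟩ : ∃ m : ℕ, 1 ≤ m ∧ m ≤ k ∧ C * m ≤ n ∧
      (k : ℝ) ≤ 2 * C * m := by
    have hfl : 1 ≤ ⌊(n : ℝ) / C⌋₊ := (Nat.one_le_floor_iff _).2 ((one_le_div hC0).2 hn)
    have hfl' : (⌊(n : ℝ) / C⌋₊ : ℝ) ≤ n / C := Nat.floor_le (by positivity)
    have hfl'' : (n : ℝ) / C < ⌊(n : ℝ) / C⌋₊ + 1 := Nat.lt_floor_add_one _
    rw [le_div_iff₀ hC0] at hfl'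
    rw [div_lt_iff₀ hC0] at hfl''
    have hf1 : (1 : ℝ) ≤ ⌊(n : ℝ) / C⌋₊ := by exact_mod_cast hfl
    rcases le_total k ⌊(n : ℝ) / C⌋₊ with hle | hle
    · have : (k : ℝ) ≤ ⌊(n : ℝ) / C⌋₊ := by exact_mod_cast hle
      refine ⟨k, hk1, le_rfl, by nlinarith, ?_⟩
      have : (0 : ℝ) ≤ k := Nat.cast_nonneg k
      nlinarith
    · refine ⟨_, hfl, hle, by linarith, ?_⟩
      have : (k : ℝ) ≤ n := by exact_mod_cast hkn
      nlinarith
  have hmp : m < p := hmk.trans_lt hkp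
  have hm0 : m - 1 < p := by omega
  -- By minimality of k, ρ_{m-1} < b; the 0-based index m - 1 is the last of the top m features.
  have hm1' : tailSum l m ≤ b * (n * l ⟨m - 1, hm0⟩) := by
    have h1 : rho n l (m - 1) < b := by
      by_contra! hcon
      have := hk.2 hcon
      omega
    rw [rho, dif_pos hm0, div_lt_iff₀ (mul_pos hn0 (h.eigenvalue_pos _))] at h1
    refine le_trans ?_ h1.le
    rw [tailSum_eq, tailSum_eq]
    refine Finset.sum_le_sum_of_subset_of_nonneg (fun i hi => ?_)
      fun i _ _ => (h.eigenvalue_pos i).le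
    simp only [Finset.mem_compl, mem_headSet] at hi ⊢
    omega
  have hcardR : C * ((headSet p m).card : ℝ) ≤ n :=
    le_trans (mul_le_mul_of_nonneg_left (by exact_mod_cast card_headSet_le p m) hC0.le) hmC
  have h1 := hb.tail k hkC
  have h2 := h.tail_form_le hσ n hmp
  have h3 := hb.head (headSet p m) hcardR
  have h4 := h.tail_trace_le hσ n hkp
  have h5 := h.norm_sq_featureVec_le (n := n) hσ (s := headSet p m)
    ((card_headSet_le p m).trans (hmk.trans hkn))
  set U : ℝ := 32 * σ ^ 2 / 3 * 4 with hU
  have hU0 : 0 < U := by positivity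
  set s := tailSum l k with hs
  set Q := tailSum (fun i => l i ^ 2) k with hQ
  have hb0 : 0 ≤ b := by linarith
  have hB := (measureReal_union_le _ _).trans (add_le_add ((measureReal_union_le _ _).trans
    (add_le_add ((measureReal_union_le _ _).trans (add_le_add ((measureReal_union_le _ _).trans
      (add_le_add h1 h2)) h3)) h4)) h5)
  refine le_trans ?_ (one_sub_le_sampleProb hB fun S hS => ?_)
  · linarith [hb.exp_neg_le]
  · simp only [Set.mem_union, not_or] at hS
    obtain ⟨⟨⟨⟨hS1, hS2⟩, hS3⟩, hS4⟩, hS5⟩ := hS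
    replace hS1 := not_not.1 hS1
    replace hS2 := not_not.1 hS2
    replace hS3 := not_not.1 hS3
    replace hS4 := not_not.1 hS4
    replace hS5 := not_not.1 hS5
    obtain ⟨y, hy, hgap, hyz⟩ := h.exists_shiftGap S hkp hS1
    refine ⟨_, _, hgap, ?_, ?_⟩
    -- In units of U n λ_i, the constant 7 + b is 4 from ‖z_i‖², 3 from the deviation term and b
    -- from the tail sum beyond m.
    · have h6 := le_partVariance_head h.eigenvalue_pos hy hmk hmp.le
        (by positivity : (0 : ℝ) ≤ n / 8) (M := U * n * (7 + b)) (by positivity) hS2 hS5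
        (fun i hi => by
          have hi' := mem_headSet.1 hi
          have hl1 : l ⟨m - 1, hm0⟩ ≤ l i := h.eigenvalue_antitone (by
            rw [Fin.le_def]; simp only; omega)
          have hl2 : l ⟨m, hmp⟩ ≤ l i := h.eigenvalue_antitone (by
            rw [Fin.le_def]; simp only; omega)
          have e1 : tailSum l m ≤ b * (n * l i) := hm1'.trans (by gcongr)
          have e2 : l ⟨m, hmp⟩ * (3 * n) ≤ l i * (3 * n) := by gcongr
          have e3 : U * (tailSum l m + l ⟨m, hmp⟩ * (3 * n)) ≤
            U * (b * (n * l i) + l i * (3 * n)) := by gcongr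
          refine (add_le_add_right e3 _).trans (le_of_eq ?_)
          ring) hS3
      have e : (m : ℝ) * (n / 8 / (U * n * (7 + b)) ^ 2) = m / n / (8 * U ^ 2 * (7 + b) ^ 2) := by
        field_simp
      rw [e, div_le_iff₀ (by positivity)] at h6
      calc (k : ℝ) / n ≤ 2 * C * m / n := by gcongr
        _ = 2 * C * (m / n) := by ring
        _ ≤ 2 * C * (partVariance l y (headSet p k) * (8 * U ^ 2 * (7 + b) ^ 2)) := by gcongr
        _ = _ := by ring
    · have h6 : ∀ i, l i ^ 2 * ‖y i‖ ^ 2 ≤ 64 / s ^ 2 * (l i ^ 2 * ‖featureVec l S i‖ ^ 2) := by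
        intro i
        have h7 : (s / 8 * ‖y i‖) ^ 2 ≤ ‖featureVec l S i‖ ^ 2 :=
          pow_le_pow_left₀ (by positivity) (hyz i) 2
        have h8 : ‖y i‖ ^ 2 = 64 / s ^ 2 * (s / 8 * ‖y i‖) ^ 2 := by
          field_simp
          norm_num
        rw [h8, mul_left_comm]
        gcongr
      calc partVariance l y (headSet p k)ᶜ ≤
            ∑ i ∈ (headSet p k)ᶜ, 64 / s ^ 2 * (l i ^ 2 * ‖featureVec l S i‖ ^ 2) :=
          Finset.sum_le_sum fun i _ => h6 i
        _ ≤ 64 / s ^ 2 * (U * (2 * n * Q)) := by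
          rw [← Finset.mul_sum]
          gcongr
        _ = _ := by
          have hQ0 : 0 < Q := tailSum_sq_pos h hkp
          rw [effRank, ← hs, ← hQ]
          field_simp
          ring

end MNI

/-! ### The sign of the variance gap in the two regimes -/

namespace MNI

variable {n p : ℕ} {D : Measure ((Fin p → ℝ) × ℝ)} {l θ : Fin p → ℝ} {σ : ℝ} {k : ℕ}
  {X : Matrix (Fin n) (Fin p) ℝ} {H T : ℝ}

lemma ShiftGap.beneficial_iff (h : ShiftGap D l θ k X H T) {α β : ℝ} :
    BeneficialShift D θ (shiftedCov l k α β) X ↔ (α - 1) * H < (1 - β) * T := by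
  rw [BeneficialShift, ← sub_neg, h]
  constructor <;> intro h <;> linarith

lemma ShiftGap.malignant_iff (h : ShiftGap D l θ k X H T) {α β : ℝ} :
    MalignantShift D θ (shiftedCov l k α β) X ↔ (1 - β) * T < (α - 1) * H := by
  rw [MalignantShift, ← sub_pos, h]
  constructor <;> intro h <;> linarith

lemma shiftRatio_mul_of_gt {α β : ℝ} (hα : 1 < α) (hβ : β < 1) :
    shiftRatio α β * (1 - β) = α - 1 := by
  rw [shiftRatio, abs_of_pos (div_pos (by linarith) (by linarith)),
    div_mul_cancel₀ _ (by linarith)]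

lemma shiftRatio_mul_of_lt {α β : ℝ} (hα : α < 1) (hβ : 1 < β) :
    shiftRatio α β * (1 - β) = α - 1 := by
  rw [shiftRatio, abs_of_pos (div_pos_of_neg_of_neg (by linarith) (by linarith)),
    div_mul_cancel₀ _ (by linarith)]

/-- ∑_{i>k} λ_i² ≤ λ_{k+1} ∑_{i>k} λ_i gives n / R_k ≤ 1 / ρ_k. The upper bound 1 is what lets the
mild regime force k to be a small fraction of n. -/
lemma IsLinearRegression.div_effRank_mem_Ioc (h : IsLinearRegression D l θ σ)
    (hk : 1 ≤ rho n l k) : (n : ℝ) / effRank l k ∈ Set.Ioc 0 1 := by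
  have hkp := lt_of_one_le_rho le_rfl hk
  have hn0 : (0 : ℝ) < n := Nat.cast_pos.2 (pos_of_one_le_rho le_rfl hk)
  have hs0 := h.tailSum_pos hkp
  have hQ0 := tailSum_sq_pos h hkp
  have hls := mul_eigenvalue_le_tailSum h le_rfl hk hkp
  have hQ : tailSum (fun i => l i ^ 2) k ≤ l ⟨k, hkp⟩ * tailSum l k := by
    rw [tailSum_eq, tailSum_eq, Finset.mul_sum]
    refine Finset.sum_le_sum fun i hi => ?_
    rw [sq]
    refine mul_le_mul_of_nonneg_right (h.eigenvalue_antitone ?_) (h.eigenvalue_pos i).le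
    rw [Fin.le_def]
    simpa using hi
  rw [effRank]
  refine ⟨by positivity, ?_⟩
  rw [div_div_eq_mul_div, div_le_one (by positivity)]
  nlinarith

/-- In the mild regime the tail part of the variance dominates the head part. -/
lemma head_lt_tail_of_mild {A B r u v H T : ℝ} (hA : 0 < A) (hB : 0 < B) (hr : 0 ≤ r)
    (hv : 0 < v) (hH : H ≤ A * u) (hT : v ≤ B * T) (h : r * u ≤ 1 / (2 * A * B) * v) :
    r * H < T := by
  have hT0 : 0 < T := by
    by_contra hcon
    nlinarith
  have h1 : r * H ≤ A * (r * u) := by nlinarith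
  have h2 : A * (r * u) ≤ A * (1 / (2 * A * B) * (B * T)) :=
    mul_le_mul_of_nonneg_left (h.trans (mul_le_mul_of_nonneg_left hT (by positivity))) hA.le
  have e : A * (1 / (2 * A * B) * (B * T)) = T / 2 := by field_simp
  linarith

/-- In the severe regime the head part of the variance dominates the tail part. -/
lemma tail_lt_head_of_severe {A B r u v H T : ℝ} (hA : 0 < A) (hB : 0 < B) (hr : 0 < r)
    (hu : 0 < u) (hH : u ≤ A * H) (hT : T ≤ B * v) (h : v ≤ 1 / (2 * A * B) * (r * u)) :
    T < r * H := by
  have hH0 : 0 < H := by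
    by_contra hcon
    nlinarith
  have h2 : B * v ≤ B * (1 / (2 * A * B) * (r * (A * H))) :=
    mul_le_mul_of_nonneg_left (h.trans (mul_le_mul_of_nonneg_left
      (mul_le_mul_of_nonneg_left hH hr.le) (by positivity))) hB.le
  have e : B * (1 / (2 * A * B) * (r * (A * H))) = r * H / 2 := by field_simp
  have : 0 < r * H := mul_pos hr hH0
  linarith

end MNI

/-! ### Choice of the constants and proof of the four claims -/

theorem theorem3p5 (σ : ℝ) (hσ : 0 < σ) :
    ∃ b c : ℝ, 1 < b ∧ 1 < c ∧
      -- shifts of both factors in the same direction, for every sample size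
      (∀ (n p k : ℕ) (l θ : Fin p → ℝ) (D : Measure ((Fin p → ℝ) × ℝ)) (α β : ℝ),
        IsLinearRegression D l θ σ → 1 ≤ k → k ≤ n → b ≤ rho n l k → 0 ≤ α → 0 ≤ β →
        ((α < 1 ∧ β ≤ 1 ∨ α ≤ 1 ∧ β < 1) →
          1 - c * Real.exp (-(n / c)) ≤
            sampleProb n D (BeneficialShift D θ (shiftedCov l k α β))) ∧
        ((1 < α ∧ 1 ≤ β ∨ 1 ≤ α ∧ 1 < β) →
          1 - c * Real.exp (-(n / c)) ≤
            sampleProb n D (MalignantShift D θ (shiftedCov l k α β)))) ∧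
      -- shifts in opposite directions, along sequences of problems with sample size `n → ∞`
      (∀ (p k : ℕ → ℕ) (l θ : ∀ n, Fin (p n) → ℝ)
        (D : ∀ n, Measure ((Fin (p n) → ℝ) × ℝ)) (α β : ℕ → ℝ),
        (∀ᶠ n in atTop, IsLinearRegression (D n) (l n) (θ n) σ ∧ 1 ≤ k n ∧ k n ≤ n ∧
          b ≤ rho n (l n) (k n) ∧ 0 ≤ α n ∧ 0 ≤ β n) →
        -- mild regime; the second hypothesis is automatic if `α`, `β` do not depend on `n`
        (MildlyOverparameterized p k l α β →
          (∃ a : ℝ, 0 < a ∧ ∀ᶠ n in atTop, a ≤ shiftRatio (α n) (β n) ∨ (k n : ℝ) ≤ n / c) →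
          ((∀ᶠ n in atTop, 1 < α n ∧ β n < 1) →
            ∀ᶠ n : ℕ in atTop, 1 - c * Real.exp (-(n / c)) ≤
              sampleProb n (D n)
                (BeneficialShift (D n) (θ n) (shiftedCov (l n) (k n) (α n) (β n)))) ∧
          ((∀ᶠ n in atTop, α n < 1 ∧ 1 < β n) →
            ∀ᶠ n : ℕ in atTop, 1 - c * Real.exp (-(n / c)) ≤
              sampleProb n (D n)
                (MalignantShift (D n) (θ n) (shiftedCov (l n) (k n) (α n) (β n))))) ∧
        -- severe regime, with `k` the least index at which `ρ` reaches `b`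
        (SeverelyOverparameterized p k l α β →
          (∀ᶠ n in atTop, IsLeast {j | b ≤ rho n (l n) j} (k n)) →
          ((∀ᶠ n in atTop, 1 < α n ∧ β n < 1) →
            ∀ᶠ n : ℕ in atTop, 1 - c * Real.exp (-(n / c)) ≤
              sampleProb n (D n)
                (MalignantShift (D n) (θ n) (shiftedCov (l n) (k n) (α n) (β n)))) ∧
          ((∀ᶠ n in atTop, α n < 1 ∧ 1 < β n) →
            ∀ᶠ n : ℕ in atTop, 1 - c * Real.exp (-(n / c)) ≤
              sampleProb n (D n)
                (BeneficialShift (D n) (θ n) (shiftedCov (l n) (k n) (α n) (β n)))))) := by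
  obtain ⟨C, hC1, hC⟩ := exists_const_lower_bounds hσ
  have hC0 : 0 < C := by linarith
  have hlow : ∀ {n p : ℕ} {D : Measure ((Fin p → ℝ) × ℝ)} {l θ : Fin p → ℝ},
      IsLinearRegression D l θ σ → HasLowerBounds D l n C := fun h => ⟨hC1, (hC h).1, (hC h).2⟩
  set U : ℝ := 32 * σ ^ 2 / 3 * 4 with hU
  have hU0 : 0 < U := by positivity
  -- Large enough to dominate every prefactor up to 11, to make the claim vacuous for n < C, and to
  -- turn k ≤ n / c into C (k + 1) ≤ n.
  set c : ℝ := 12 * C with hc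
  have herr : ∀ (n : ℕ) {a : ℝ}, a ≤ 11 →
      1 - c * Real.exp (-(n / c)) ≤ 1 - a * Real.exp (-(n / C)) := by
    intro n a ha
    have h1 : Real.exp (-(n / C)) ≤ Real.exp (-(n / c)) := by
      rw [Real.exp_le_exp, neg_le_neg_iff]
      exact div_le_div_of_nonneg_left (Nat.cast_nonneg n) hC0 (by linarith)
    have h2 : a * Real.exp (-(n / C)) ≤ c * Real.exp (-(n / C)) :=
      mul_le_mul_of_nonneg_right (by linarith) (Real.exp_pos _).le
    have h3 : c * Real.exp (-(n / C)) ≤ c * Real.exp (-(n / c)) :=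
      mul_le_mul_of_nonneg_left h1 (by linarith)
    linarith
  have hsmall : ∀ (n : ℕ), (n : ℝ) < C → 1 - c * Real.exp (-(n / c)) ≤ 0 := by
    intro n hn
    have h1 : (n : ℝ) / c ≤ 1 / 12 := by
      rw [div_le_div_iff₀ (by linarith) (by norm_num)]
      linarith
    have h2 := Real.add_one_le_exp (-((n : ℝ) / c))
    nlinarith
  -- C is only known to be at least 1, while b must exceed 1.
  refine ⟨C + 1, c, by linarith, by linarith, ?_, ?_⟩
  · intro n p k l θ D α β h hk1 hkn hk hα hβ
    have := h.isProbabilityMeasure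
    rcases lt_or_ge (n : ℝ) C with hn | hn
    · exact ⟨fun _ => (hsmall n hn).trans measureReal_nonneg,
        fun _ => (hsmall n hn).trans measureReal_nonneg⟩
    have hR := (herr n (by norm_num)).trans (h.prob_parts_pos (hlow h) hk1 (by linarith) hn)
    refine ⟨fun hαβ => hR.trans (sampleProb_mono ?_), fun hαβ => hR.trans (sampleProb_mono ?_)⟩
    · rintro X ⟨H, T, hgap, hH, hT⟩
      rw [hgap.beneficial_iff]
      rcases hαβ with ⟨h1, h2⟩ | ⟨h1, h2⟩ <;> nlinarith
    · rintro X ⟨H, T, hgap, hH, hT⟩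
      rw [hgap.malignant_iff]
      rcases hαβ with ⟨h1, h2⟩ | ⟨h1, h2⟩ <;> nlinarith
  · intro p k l θ D α β hev
    constructor
    · rintro ⟨-, ho⟩ ⟨a, ha, hak⟩
      have hkey : ∀ᶠ n : ℕ in atTop, 1 - c * Real.exp (-(n / c)) ≤ sampleProb n (D n) fun X =>
          ∃ H T, ShiftGap (D n) (l n) (θ n) (k n) X H T ∧ shiftRatio (α n) (β n) * H < T := by
        -- The little-o is used twice: with constant 1 / (2AB) to compare the two parts, and with a
        -- / c to deduce k ≤ n / c when C_{αβ} ≥ a.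
        filter_upwards [hev, hak, ho.def (by positivity : 0 < 1 / (2 * (256 * U) * (256 * U ^ 2))),
          ho.def (by positivity : 0 < a / c)] with n ⟨h, hk1, hkn, hk, _⟩ hak ho1 ho2
        have := h.isProbabilityMeasure
        have hn0 : (0 : ℝ) < n := Nat.cast_pos.2 (by omega)
        have hr0 : 0 ≤ shiftRatio (α n) (β n) := abs_nonneg _
        obtain ⟨hv0, hv1⟩ := h.div_effRank_mem_Ioc (by linarith : 1 ≤ rho n (l n) (k n))
        rw [Real.norm_of_nonneg (by positivity), Real.norm_of_nonneg hv0.le] at ho1 ho2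
        have hkc : (k n : ℝ) ≤ n / c := by
          rcases hak with hak | hak
          · have h1 : a * ((k n : ℝ) / n) ≤ a / c :=
              calc a * ((k n : ℝ) / n) ≤ shiftRatio (α n) (β n) * ((k n : ℝ) / n) := by gcongr
                _ ≤ a / c * (n / effRank (l n) (k n)) := ho2
                _ ≤ a / c := mul_le_of_le_one_right (by positivity) hv1
            rw [div_eq_mul_one_div a c] at h1
            have h2 := le_of_mul_le_mul_left h1 ha
            rw [div_le_div_iff₀ hn0 (by positivity)] at h2
            rw [le_div_iff₀ (by positivity)]
            linarith
          · exact hak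
        rw [le_div_iff₀ (by positivity)] at hkc
        have hk1' : (1 : ℝ) ≤ k n := by exact_mod_cast hk1
        have hnk : C * (k n + 1) ≤ n := by nlinarith
        refine (herr n (by norm_num)).trans ((h.prob_head_le_tail_ge hσ (hlow h)
          (by linarith) hnk).trans (sampleProb_mono ?_))
        rintro X ⟨H, T, hgap, hH, hT⟩
        exact ⟨H, T, hgap, head_lt_tail_of_mild (by positivity) (by positivity) hr0 hv0 hH hT ho1⟩
      constructor <;> intro hαβ <;> filter_upwards [hev, hkey, hαβ] with n ⟨h, _⟩ hn ⟨h1, h2⟩ <;>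
        have := h.isProbabilityMeasure <;> refine hn.trans (sampleProb_mono ?_) <;>
        rintro X ⟨H, T, hgap, hHT⟩
      -- The claim is C_{αβ} H < T multiplied by 1 - β, which is positive here and negative in the
      -- next case, where the inequality reverses.
      · rw [hgap.beneficial_iff, ← shiftRatio_mul_of_gt h1 h2]
        nlinarith
      · rw [hgap.malignant_iff, ← shiftRatio_mul_of_lt h1 h2]
        nlinarith
    · intro ho hleast
      have hkey : (∀ᶠ n in atTop, β n ≠ 1 ∧ 0 < shiftRatio (α n) (β n)) →
          ∀ᶠ n : ℕ in atTop, 1 - c * Real.exp (-(n / c)) ≤ sampleProb n (D n) fun X =>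
            ∃ H T, ShiftGap (D n) (l n) (θ n) (k n) X H T ∧ T < shiftRatio (α n) (β n) * H := by
        intro hβr
        -- Eventuality along the restricted filter becomes an implication from β ≠ 1, supplied by
        -- `hβr`.
        have ho1 := eventually_inf_principal.1 (ho.def (by positivity :
          0 < 1 / (2 * (16 * C * U ^ 2 * (7 + (C + 1)) ^ 2) * (128 * U))))
        filter_upwards [hev, hleast, ho1, hβr, eventually_ge_atTop ⌈C⌉₊] with n
          ⟨h, hk1, hkn, hk, _⟩ hl ho1 ⟨hβ, hr0⟩ hnC
        have := h.isProbabilityMeasure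
        have hn0 : (0 : ℝ) < n := Nat.cast_pos.2 (by omega)
        have hk0 : (0 : ℝ) < k n := Nat.cast_pos.2 hk1
        obtain ⟨hv0, -⟩ := h.div_effRank_mem_Ioc (by linarith : 1 ≤ rho n (l n) (k n))
        have ho1 := ho1 hβ
        rw [Real.norm_of_nonneg hv0.le, Real.norm_of_nonneg (by positivity)] at ho1
        refine (herr n le_rfl).trans ((h.prob_head_ge_tail_le hσ (hlow h) (by linarith) hk1 hkn
          hl (Nat.ceil_le.1 hnC)).trans (sampleProb_mono ?_))
        rintro X ⟨H, T, hgap, hH, hT⟩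
        exact ⟨H, T, hgap, tail_lt_head_of_severe (by positivity) (by positivity) hr0
          (by positivity) hH hT ho1⟩
      constructor <;> intro hαβ
      · have hβr : ∀ᶠ n in atTop, β n ≠ 1 ∧ 0 < shiftRatio (α n) (β n) :=
          hαβ.mono fun n hn => ⟨hn.2.ne, abs_pos.2 (div_ne_zero (by linarith [hn.1])
            (by linarith [hn.2]))⟩
        filter_upwards [hev, hkey hβr, hαβ] with n ⟨h, _⟩ hn ⟨h1, h2⟩
        have := h.isProbabilityMeasure
        refine hn.trans (sampleProb_mono ?_)
        rintro X ⟨H, T, hgap, hHT⟩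
        rw [hgap.malignant_iff, ← shiftRatio_mul_of_gt h1 h2]
        nlinarith
      · have hβr : ∀ᶠ n in atTop, β n ≠ 1 ∧ 0 < shiftRatio (α n) (β n) :=
          hαβ.mono fun n hn => ⟨hn.2.ne', abs_pos.2 (div_ne_zero (by linarith [hn.1])
            (by linarith [hn.2]))⟩
        filter_upwards [hev, hkey hβr, hαβ] with n ⟨h, _⟩ hn ⟨h1, h2⟩
        have := h.isProbabilityMeasure
        refine hn.trans (sampleProb_mono ?_)
        rintro X ⟨H, T, hgap, hHT⟩
        rw [hgap.beneficial_iff, ← shiftRatio_mul_of_lt h1 h2]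
        nlinarith
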